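/- Let $n\ge 1$ and $t\ge 0$. Write permutations $\pi=\pi_1\cdots\pi_n$ of $[n]=\{1,\dots,n\}$ in one-line notation. Let $\mathfrak S_n(p)$ be the set of permutations of $[n]$ avoiding the pattern $p$, and $\mathfrak S_n^t(p)$ the set of those $\pi\in\mathfrak S_n(p)$ that are $t$-stack-sortable, i.e. $\mathcal S^t(\pi)=12\cdots n$, where $\mathcal S(\emptyset)=\emptyset$ and $\mathcal S(LmR)=\mathcal S(L)\,\mathcal S(R)\,m$ with $m$ the largest letter of the word $LmR$. Define $\Upsilon=\lambda^{-1}\circ\gamma\circ\varphi\circ\tau^{-1}\circ\rho$ as follows. - $\rho$ sends $\pi$ to the lattice path from $(0,0)$ to $(n,n)$ with east and north steps, never above the diagonal $y=x$, that leaves all the unit squares $[i-1,i]\times[\pi_i-1,\pi_i]$, $1\le i\le n$, to its left (above it) and is as close to the diagonal as possible; that is, its $i$-th east step is at height $\min_{j\ge i}\pi_j-1$. - $\tau$ is the bijection from plane trees with $n$ edges to such paths that traverses the tree in pre-order and records an east step for each downward traversal of an edge and a north step for each upward traversal. - $\varphi$ sends a plane tree $T$ with $n$ edges to the binary tree on its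 $n$ non-root nodes in which the left child of $x$ is the leftmost child of $x$ in $T$, and the right child of $x$ is the sibling of $x$ in $T$ immediately to its right (the root is the leftmost child of the root of $T$). - $\gamma$ replaces, in a binary tree, every subtree whose root is the left child of a node on the right arm (the maximal path of right edges starting at the root) by its mirror image. - $\lambda^{-1}$ labels the nodes of a binary tree by $1,\dots,n$ in right pre-order (root, then right subtree, then left subtree) and reads the labels in in-order. For a permutation $\pi$ of $[n]$, $\pi_i$ is a *right-to-left minimum* if $\pi_i<\pi_j$ for all $j>i$; let $\pi_{i_1}<\dots<\pi_{i_m}$ be the right-to-left minima and put $i_0=0$. The letter $\pi_j$ is a *descent top* if $j<n$ and $\pi_j>\pi_{j+1}$. Define: - $\mathsf{pone}(\pi)$: the position of the letter $1$; - $\mathsf{prmi}(\pi)$: the number of $k\in\{1,\dots,m\}$ such that $k=1$, or $k\ge2$ and $\pi_{i_k}-1=i_{k-1}$; - $\mathsf{inv}(\pi)$: the number of pairs $i<j$ with $\pi_i>\pi_j$; - $\mathsf{rrmi}(\pi)$: the number of $i\le\mathsf{pone}(\pi)$ with $\pi_i<\pi_k$ for all $i<k<\mathsf{pone}(\pi)$;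 - $\mathsf{rmi}(\pi)=m$: the number of right-to-left minima; - $\mathsf{rcinv}(\pi)$: the number of pairs $(i,j)$ with $\pi_i\le\pi_j$ such that $\pi_j$ is a descent top and $i_{k-1}<i\le j<i_k$ for some $k\in\{1,\dots,m\}$. **Proposition.** $\Upsilon$ is a bijection from $\mathfrak S_n(321)$ onto $\mathfrak S_n(213)$, it restricts to a bijection from $\mathfrak S_n^t(321)$ onto $\mathfrak S_n^t(213)$, and for every $\pi\in\mathfrak S_n^t(321)$, with $\sigma=\Upsilon(\pi)$, $$\mathsf{pone}(\pi)=\mathsf{rrmi}(\sigma),\qquad \mathsf{prmi}(\pi)=\mathsf{rmi}(\sigma),\qquad \mathsf{inv}(\pi)=\mathsf{rcinv}(\sigma).$$ -/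

import Mathlib

namespace StackSort

/-!
Conventions. A permutation of `[n] = {1, …, n}` is an element of `Equiv.Perm (Fin n)`: the position
(or letter) `k` of `[n]` is represented by the element of `Fin n` with value `k - 1`. Thus, for
`i : Fin n`, `(i : ℕ) + 1` is the position in `[n]` and `(π i : ℕ) + 1` is the letter at it.
-/

/-! ### Pattern avoidance -/

/-- `π` contains the pattern `p = p₁ ⋯ pₖ`: some subsequence of `π` is order isomorphic to `p`. -/
def Contains {n k : ℕ} (π : Equiv.Perm (Fin n)) (p : Fin k → ℕ) : Prop :=
  ∃ f : Fin k → Fin n, StrictMono f ∧ ∀ a b : Fin k, π (f a) < π (f b) ↔ p a < p b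

/-- The set `𝔖ₙ(p)` of the permutations of length `n` that avoid the pattern `p`. -/
def avoiders (n : ℕ) {k : ℕ} (p : Fin k → ℕ) : Set (Equiv.Perm (Fin n)) :=
  {π | ¬ Contains π p}

/-! ### The stack-sorting operation -/

/-- The stack-sorting operation on words: `S(∅) = ∅` and `S(L m R) = S(L) S(R) m`, where `m` is
the largest letter of the word. -/
def stackSort (w : List ℕ) : List ℕ :=
  match h : w.max? with
  | none => []
  | some m =>
      have : w.idxOf m < w.length := List.idxOf_lt_length_of_mem (List.max?_mem h)
      stackSort (w.take (w.idxOf m)) ++ stackSort (w.drop (w.idxOf m + 1)) ++ [m]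
termination_by w.length
decreasing_by
  · simp only [List.length_take]; omega
  · simp only [List.length_drop]; omega

/-- The one-line notation of `π`, as a word in the letters `0, …, n - 1`. -/
def oneLine {n : ℕ} (π : Equiv.Perm (Fin n)) : List ℕ :=
  List.ofFn fun i => (π i : ℕ)

/-- `π` is `t`-stack-sortable: `t` applications of the stack-sorting operation turn it into the
identity permutation. -/
def IsStackSortable {n : ℕ} (t : ℕ) (π : Equiv.Perm (Fin n)) : Prop :=
  stackSort^[t] (oneLine π) = List.range n

/-- The set `𝔖ₙᵗ(p)` of the `t`-stack-sortable permutations of length `n` that avoid `p`. -/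
def sortableAvoiders (n t : ℕ) {k : ℕ} (p : Fin k → ℕ) : Set (Equiv.Perm (Fin n)) :=
  {π | IsStackSortable t π ∧ π ∈ avoiders n p}

/-! ### Step 1: the map `ρ` from permutations to Dyck paths

A Dyck path of order `n` from `(0,0)` to `(n,n)` that does not pass above `y = x` is a Dyck word of
semilength `n`, with `U` for the east step `(1,0)` and `D` for the north step `(0,1)`. -/

/-- Dyck paths of order `n`. -/
abbrev DyckPath (n : ℕ) : Type := {p : DyckWord // p.semilength = n}

/-- The height of the path `ρ(π)` over the column of `i` (for `i < n`): the largest height `h` such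
that a path which runs along height `h` in that column has all the crosses of `π` in this and the
later columns on its left. The cross of column `j` occupies the square with lower side at
height `π j`. For `i = n` this is `n`. -/
def colHeight {n : ℕ} (π : Equiv.Perm (Fin n)) (i : ℕ) : ℕ :=
  Nat.findGreatest (fun h => ∀ j : Fin n, i ≤ (j : ℕ) → h ≤ (π j : ℕ)) n

/-- The steps of `ρ(π)` over the first `k` columns: for every column an east step at the height of
this column, and then north steps up to the height of the next column. -/
def rhoSteps {n : ℕ} (π : Equiv.Perm (Fin n)) (k : ℕ) : List DyckStep :=
  (List.range k).flatMap fun i =>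
    DyckStep.U :: List.replicate (colHeight π (i + 1) - colHeight π i) DyckStep.D

lemma colHeight_spec {n : ℕ} (π : Equiv.Perm (Fin n)) (i : ℕ) (j : Fin n) (hij : i ≤ (j : ℕ)) :
    colHeight π i ≤ (π j : ℕ) :=
  Nat.findGreatest_spec (P := fun h => ∀ j : Fin n, i ≤ (j : ℕ) → h ≤ (π j : ℕ))
    (Nat.zero_le n) (fun _ _ => Nat.zero_le _) j hij

lemma colHeight_mono {n : ℕ} (π : Equiv.Perm (Fin n)) (i : ℕ) :
    colHeight π i ≤ colHeight π (i + 1) :=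
  Nat.le_findGreatest (Nat.findGreatest_le n) fun j hj => colHeight_spec π i j (by omega)

lemma colHeight_le {n : ℕ} (π : Equiv.Perm (Fin n)) (i : ℕ) (hi : i ≤ n) : colHeight π i ≤ i := by
  have hn : colHeight π i ≤ n := Nat.findGreatest_le n
  have h1 : ((Finset.univ.filter fun j : Fin n => i ≤ (j : ℕ)).map
      (π.toEmbedding.trans Fin.valEmbedding)) ⊆ Finset.Ico (colHeight π i) n := by
    intro x hx
    simp only [Finset.mem_map, Finset.mem_filter, Finset.mem_univ, true_and] at hx
    obtain ⟨j, hj, rfl⟩ := hx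
    exact Finset.mem_Ico.2 ⟨colHeight_spec π i j hj, (π j).2⟩
  have h2 := Finset.card_le_card h1
  have h3 : (Finset.univ.filter fun j : Fin n => i ≤ (j : ℕ)).card = n - i := by
    have : ((Finset.univ.filter fun j : Fin n => i ≤ (j : ℕ)).map Fin.valEmbedding)
        = Finset.Ico i n := by
      ext x
      simp only [Finset.mem_map, Finset.mem_filter, Finset.mem_univ, true_and, Finset.mem_Ico,
        Fin.valEmbedding_apply]
      constructor
      · rintro ⟨j, hj, rfl⟩
        exact ⟨hj, j.2⟩
      · rintro ⟨h, h'⟩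
        exact ⟨⟨x, h'⟩, h, rfl⟩
    rw [← Finset.card_map Fin.valEmbedding, this, Nat.card_Ico]
  rw [Finset.card_map, h3, Nat.card_Ico] at h2
  omega

lemma colHeight_last {n : ℕ} (π : Equiv.Perm (Fin n)) : colHeight π n = n :=
  le_antisymm (Nat.findGreatest_le n) (Nat.le_findGreatest le_rfl fun j hj => by omega)

lemma rhoSteps_succ {n : ℕ} (π : Equiv.Perm (Fin n)) (k : ℕ) :
    rhoSteps π (k + 1) = rhoSteps π k ++
      DyckStep.U :: List.replicate (colHeight π (k + 1) - colHeight π k) DyckStep.D := by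
  simp [rhoSteps, List.range_succ]

lemma count_U_rhoSteps {n : ℕ} (π : Equiv.Perm (Fin n)) (k : ℕ) :
    (rhoSteps π k).count DyckStep.U = k := by
  induction k with
  | zero => simp [rhoSteps]
  | succ k ih => simp [rhoSteps_succ, ih, List.count_replicate]

lemma count_D_rhoSteps {n : ℕ} (π : Equiv.Perm (Fin n)) (k : ℕ) :
    (rhoSteps π k).count DyckStep.D = colHeight π k := by
  induction k with
  | zero => simpa [rhoSteps] using (Nat.le_zero.1 (colHeight_le π 0 (Nat.zero_le n))).symm
  | succ k ih =>
    have := colHeight_mono π k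
    simp [rhoSteps_succ, ih]
    omega

lemma rhoSteps_prefix {n : ℕ} (π : Equiv.Perm (Fin n)) (k : ℕ) (hk : k ≤ n) (i : ℕ) :
    ((rhoSteps π k).take i).count DyckStep.D ≤ ((rhoSteps π k).take i).count DyckStep.U := by
  induction k generalizing i with
  | zero => simp [rhoSteps]
  | succ k ih =>
    rw [rhoSteps_succ, List.take_append]
    rcases le_or_gt i (rhoSteps π k).length with h | h
    · simpa [Nat.sub_eq_zero_of_le h] using ih (by omega) i
    · obtain ⟨j, hj⟩ : ∃ j, i - (rhoSteps π k).length = j + 1 :=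
        ⟨i - (rhoSteps π k).length - 1, by omega⟩
      have h1 := colHeight_mono π k
      have h2 := colHeight_le π (k + 1) hk
      rw [hj, List.take_of_length_le h.le]
      simp [count_U_rhoSteps, count_D_rhoSteps, List.take_replicate, List.count_replicate]
      omega

/-- The map `ρ`: the Dyck path that leaves all crosses of `π` on its left and is as close to the
diagonal as possible. -/
def rho {n : ℕ} (π : Equiv.Perm (Fin n)) : DyckPath n :=
  ⟨{ toList := rhoSteps π n
     count_U_eq_count_D := by rw [count_U_rhoSteps, count_D_rhoSteps, colHeight_last]
     count_D_le_count_U := rhoSteps_prefix π n le_rfl }, count_U_rhoSteps π n⟩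

/-! ### Step 2: the bijection `τ` between plane trees and Dyck paths -/

/-- Plane trees: a root with a list of subtrees, in their linear order. -/
inductive PlaneTree : Type
  | node : List PlaneTree → PlaneTree

/-- The number of edges in a plane tree whose root has the given list of subtrees. -/
def forestEdges : List PlaneTree → ℕ
  | [] => 0
  | .node cs :: ts => 1 + forestEdges cs + forestEdges ts

/-- The Dyck word of a plane tree whose root has the given list of subtrees, by pre-order
traversal: an east step `U` for going down an edge, and a north step `D` for going up. -/
def forestDyck : List PlaneTree → DyckWord
  | [] => 0
  | .node cs :: ts => (forestDyck cs).nest + forestDyck ts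

/-- The inverse of `forestDyck`, by first-return decomposition. -/
def dyckForest (p : DyckWord) : List PlaneTree :=
  if p = 0 then [] else .node (dyckForest p.insidePart) :: dyckForest p.outsidePart
termination_by p.semilength
decreasing_by
  exacts [DyckWord.semilength_insidePart_lt ‹_›, DyckWord.semilength_outsidePart_lt ‹_›]

lemma semilength_forestDyck : ∀ ts, (forestDyck ts).semilength = forestEdges ts
  | [] => by simp [forestDyck, forestEdges]
  | .node cs :: ts => by
    simp [forestDyck, forestEdges, semilength_forestDyck cs, semilength_forestDyck ts]
    omega

lemma forestDyck_dyckForest (p : DyckWord) : forestDyck (dyckForest p) = p := by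
  by_cases h : p = 0
  · subst h
    simp [dyckForest, forestDyck]
  · rw [dyckForest, if_neg h, forestDyck, forestDyck_dyckForest p.insidePart,
      forestDyck_dyckForest p.outsidePart]
    exact DyckWord.nest_insidePart_add_outsidePart h
termination_by p.semilength
decreasing_by
  exacts [DyckWord.semilength_insidePart_lt h, DyckWord.semilength_outsidePart_lt h]

lemma dyckForest_forestDyck : ∀ ts, dyckForest (forestDyck ts) = ts
  | [] => by simp [dyckForest, forestDyck]
  | .node cs :: ts => by
    rw [dyckForest]
    simp [forestDyck, dyckForest_forestDyck cs, dyckForest_forestDyck ts]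

namespace PlaneTree

/-- The list of the subtrees of the root. -/
def subtrees : PlaneTree → List PlaneTree
  | node ts => ts

/-- The number of edges of a plane tree. -/
def numEdges (T : PlaneTree) : ℕ := forestEdges T.subtrees

end PlaneTree

/-- The bijection `τ` from the plane trees with `n` edges to the Dyck paths of order `n`. -/
def tau (n : ℕ) : {T : PlaneTree // T.numEdges = n} ≃ DyckPath n where
  toFun T := ⟨forestDyck T.1.subtrees, (semilength_forestDyck _).trans T.2⟩
  invFun p := ⟨.node (dyckForest p.1), by
    rw [PlaneTree.numEdges, PlaneTree.subtrees, ← semilength_forestDyck, forestDyck_dyckForest,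
      p.2]⟩
  left_inv := by
    rintro ⟨⟨ts⟩, h⟩
    simp [PlaneTree.subtrees, dyckForest_forestDyck]
  right_inv p := by
    simp [PlaneTree.subtrees, forestDyck_dyckForest]

/-! ### Step 3: the map `φ` from plane trees to binary trees -/

/-- Binary trees with `n` nodes. -/
abbrev BinTree (n : ℕ) : Type := {T : BinaryTree Unit // T.numNodes = n}

/-- The binary tree on the nodes of a list of consecutive siblings and of their descendants: the
left child of a node is its leftmost child, the right child is its next sibling to the right. -/
def forestBin : List PlaneTree → BinaryTree Unit
  | [] => .nil
  | .node cs :: ts => .node () (forestBin cs) (forestBin ts)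

lemma numNodes_forestBin : ∀ ts, (forestBin ts).numNodes = forestEdges ts
  | [] => by simp [forestBin, forestEdges]
  | .node cs :: ts => by
    simp [forestBin, forestEdges, numNodes_forestBin cs, numNodes_forestBin ts]
    omega

/-- The map `φ`. The nodes of `φ(T)` are the non-root nodes of `T`. -/
def phi {n : ℕ} (T : {T : PlaneTree // T.numEdges = n}) : BinTree n :=
  ⟨forestBin T.1.subtrees, (numNodes_forestBin _).trans T.2⟩

/-! ### Step 4: the restricted mirror symmetry `γ` -/

/-- The mirror image of a binary tree. -/
def mirror : BinaryTree Unit → BinaryTree Unit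
  | .nil => .nil
  | .node a l r => .node a (mirror r) (mirror l)

/-- Mirror every subtree whose root is the left child of a node on the right arm. -/
def restrictedMirror : BinaryTree Unit → BinaryTree Unit
  | .nil => .nil
  | .node a l r => .node a (mirror l) (restrictedMirror r)

lemma numNodes_mirror (T : BinaryTree Unit) : (mirror T).numNodes = T.numNodes := by
  induction T with
  | nil => rfl
  | node a l r hl hr => simp only [mirror, BinaryTree.numNodes, hl, hr]; omega

lemma numNodes_restrictedMirror (T : BinaryTree Unit) :
    (restrictedMirror T).numNodes = T.numNodes := by
  induction T with
  | nil => rfl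
  | node a l r hl hr => simp only [restrictedMirror, BinaryTree.numNodes, numNodes_mirror, hr]

/-- The restricted mirror symmetry `γ`. -/
def gamma {n : ℕ} (T : BinTree n) : BinTree n :=
  ⟨restrictedMirror T.1, (numNodes_restrictedMirror _).trans T.2⟩

/-! ### Step 5: the map `λ⁻¹` from binary trees to permutations -/

/-- The natural labeling of a binary tree, with labels `s, s + 1, …` in right pre-order: first the
root, then the right subtree, and finally the left subtree. -/
def naturalLabeling (s : ℕ) : BinaryTree Unit → BinaryTree ℕ
  | .nil => .nil
  | .node _ l r => .node s (naturalLabeling (s + 1 + r.numNodes) l) (naturalLabeling (s + 1) r)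

/-- The labels of a labeled binary tree, read in in-order. -/
def inorderWord : BinaryTree ℕ → List ℕ
  | .nil => []
  | .node a l r => inorderWord l ++ a :: inorderWord r

lemma perm_inorderWord (T : BinaryTree Unit) (s : ℕ) :
    (inorderWord (naturalLabeling s T)).Perm (List.range' s T.numNodes) := by
  induction T generalizing s with
  | nil => simp [inorderWord, naturalLabeling]
  | node a l r hl hr =>
    have h : List.range' s (l.numNodes + r.numNodes + 1) =
        s :: (List.range' (s + 1) r.numNodes ++
          List.range' (s + 1 + r.numNodes) l.numNodes) := by
      rw [List.range'_append_1, List.range'_succ, Nat.add_comm l.numNodes]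
    rw [BinaryTree.numNodes, h, naturalLabeling, inorderWord]
    exact List.perm_middle.trans
      ((List.perm_append_comm.trans ((hr _).append (hl _))).cons s)

lemma inorderWord_perm_range {n : ℕ} (T : BinTree n) :
    (inorderWord (naturalLabeling 0 T.1)).Perm (List.range n) := by
  have h := perm_inorderWord T.1 0
  rwa [T.2, ← List.range_eq_range'] at h

lemma length_inorderWord {n : ℕ} (T : BinTree n) :
    (inorderWord (naturalLabeling 0 T.1)).length = n := by
  rw [(inorderWord_perm_range T).length_eq, List.length_range]

/-- The map `λ⁻¹`: the permutation whose one-line notation is the in-order reading of the natural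
labeling (with labels `0, …, n - 1`). -/
def lambdaInv {n : ℕ} (T : BinTree n) : Equiv.Perm (Fin n) where
  toFun i := ⟨(inorderWord (naturalLabeling 0 T.1))[(i : ℕ)]'(by
      rw [length_inorderWord]; exact i.2),
    List.mem_range.1 ((inorderWord_perm_range T).mem_iff.1 (List.getElem_mem _))⟩
  invFun a := ⟨(inorderWord (naturalLabeling 0 T.1)).idxOf (a : ℕ), by
    have h := List.idxOf_lt_length_of_mem
      ((inorderWord_perm_range T).mem_iff.2 (List.mem_range.2 a.2))
    rwa [length_inorderWord] at h⟩
  left_inv i := by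
    ext
    exact ((inorderWord_perm_range T).nodup_iff.2 List.nodup_range).idxOf_getElem _ _
  right_inv a := by
    ext
    exact List.getElem_idxOf _

/-! ### The bijection `Υ` -/

/-- `Υ = λ⁻¹ ∘ γ ∘ φ ∘ τ⁻¹ ∘ ρ`. The formula makes sense for every permutation, but only its
restriction to the `321`-avoiding permutations is of interest. -/
def upsilon {n : ℕ} (π : Equiv.Perm (Fin n)) : Equiv.Perm (Fin n) :=
  lambdaInv (gamma (phi ((tau n).symm (rho π))))

/-! ### Permutation statistics -/

/-- The letter at position `i` is a right-to-left minimum: all letters after it are larger. -/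
def IsRmi {n : ℕ} (π : Equiv.Perm (Fin n)) (i : Fin n) : Prop :=
  ∀ j, i < j → π i < π j

/-- The letter at position `i` is a descent top: it is followed directly by a smaller letter. -/
def IsDescentTop {n : ℕ} (π : Equiv.Perm (Fin n)) (i : Fin n) : Prop :=
  ∃ j : Fin n, (j : ℕ) = (i : ℕ) + 1 ∧ π j < π i

/-- If `π_{i₁} < ⋯ < π_{iₘ}` are the right-to-left minima, then `(j, i) = (i_{k-1}, i_k)` for
some `k ≥ 2`: the letters at `j` and `i` are consecutive right-to-left minima. -/
def IsConsecutiveRmi {n : ℕ} (π : Equiv.Perm (Fin n)) (j i : Fin n) : Prop :=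
  IsRmi π j ∧ IsRmi π i ∧ π j < π i ∧ ∀ l, IsRmi π l → ¬ (π j < π l ∧ π l < π i)

/-- The right-to-left minimum at position `i = i_k` is prime: `k = 1`, or `k ≥ 2` and
`π_{i_k} - 1 = i_{k-1}`. (With letters and positions counted from `0` as in `Fin n`, the letter
`π_{i_k}` is `π i + 1` and the position `i_{k-1}` is `j + 1`.) -/
def IsPrimeRmi {n : ℕ} (π : Equiv.Perm (Fin n)) (i : Fin n) : Prop :=
  IsRmi π i ∧ ((¬ ∃ j, IsConsecutiveRmi π j i) ∨
    ∃ j, IsConsecutiveRmi π j i ∧ ((π i : ℕ) + 1) - 1 = (j : ℕ) + 1)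

/-- `pone(π)`: the position of the letter `1` in `π`. -/
noncomputable def pone {n : ℕ} [NeZero n] (π : Equiv.Perm (Fin n)) : ℕ :=
  ((π.symm 0 : Fin n) : ℕ) + 1

open Classical in
/-- `prmi(π)`: the number of prime right-to-left minima of `π`. -/
noncomputable def prmi {n : ℕ} (π : Equiv.Perm (Fin n)) : ℕ :=
  (Finset.univ.filter fun i => IsPrimeRmi π i).card

/-- `inv(π)`: the number of inversions of `π`. -/
def inv {n : ℕ} (π : Equiv.Perm (Fin n)) : ℕ :=
  (Finset.univ.filter fun ij : Fin n × Fin n => ij.1 < ij.2 ∧ π ij.2 < π ij.1).card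

open Classical in
/-- `rrmi(π)`: the number of restricted right-to-left minima of `π`, that is, of letters at
positions `i ≤ pone(π)` that are smaller than all letters strictly between `i` and `pone(π)`. -/
noncomputable def rrmi {n : ℕ} [NeZero n] (π : Equiv.Perm (Fin n)) : ℕ :=
  (Finset.univ.filter fun i : Fin n =>
    (i : ℕ) + 1 ≤ pone π ∧ ∀ k : Fin n, i < k → (k : ℕ) + 1 < pone π → π i < π k).card

open Classical in
/-- `rmi(π)`: the number of right-to-left minima of `π`. -/
noncomputable def rmi {n : ℕ} (π : Equiv.Perm (Fin n)) : ℕ :=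
  (Finset.univ.filter fun i => IsRmi π i).card

/-- `(i, j)` is a restricted coinversion: `π_i ≤ π_j`, the letter `π_j` is a descent top, and
`i_{k-1} < i ≤ j < i_k` for some `k`, where `i₁, …, iₘ` are the positions of the right-to-left
minima in the order of their letters and `i₀ = 0`. Here `r = i_k`; if `k = 1`, there is
no `q` below, and the condition `i₀ < i` always holds. -/
def IsRestrictedCoinversion {n : ℕ} (π : Equiv.Perm (Fin n)) (i j : Fin n) : Prop :=
  π i ≤ π j ∧ IsDescentTop π j ∧
    ∃ r, IsRmi π r ∧ (∀ q, IsConsecutiveRmi π q r → q < i) ∧ i ≤ j ∧ j < r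

open Classical in
/-- `rcinv(π)`: the number of restricted coinversions of `π`. -/
noncomputable def rcinv {n : ℕ} (π : Equiv.Perm (Fin n)) : ℕ :=
  (Finset.univ.filter fun ij : Fin n × Fin n => IsRestrictedCoinversion π ij.1 ij.2).card

end StackSort

/-! Sorting is reduced to pattern avoidance. An inversion survives one stack-sort exactly when a
letter larger than both lies between its two letters (`bef_stackSort_iff`). Words avoiding 3241 are
closed under stack-sorting, and on them one application turns the pattern 2 3 ⋯ (k+3) 1 into 2 3 ⋯
(k+2) 1 and creates no other such pattern. So such a word is `t`-stack-sortable iff it avoids 2 3 ⋯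
(t+2) 1 (`iterate_stackSort_eq_range_iff`). Avoiding 321 or 213 implies avoiding 3241, so the
criterion serves both sides.

Both sides are then read off one binary tree, `permTree π` = φ(τ⁻¹(ρ(π))). Its nodes in pre-order
are the columns of the path ρ(π): the number of left edges above the node of column i is the
distance i - `colHeight π i` to the diagonal, and the node has no left child iff a north step
follows, that is, iff π has a right-to-left minimum at i (`treeColumns_permTree`,
`isRmi_iff_colHeight_lt`). If π avoids 321, sortability bounds the distances, and `inv` is their sum
over the right-to-left minima. For any π, `prmi` counts the columns at distance 0 (the right arm),
and `pone` is the length of the left arm.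

On the 213 side, a tree with root label s has the word L s R, where L > R > s letterwise
(`IsSplit`), and all quantities follow by recursion. Right-to-left minima form the right arm; the
letters that precede a smaller letter lie in the left subtrees of arm nodes, where increasing
subsequences are paths turning right. The map γ keeps the right arm and mirrors these left subtrees,
which exchanges the two descriptions.

Bijectivity: 213-avoiders are exactly the words of trees (`lambdaInv_bijOn`), γ is an involution,
and a 321-avoider is determined by its path, every path occurring (`eq_of_colHeight_eq`,
`exists_avoids321_colHeight_eq`). -/

namespace StackSort

/-! ### The order of the letters in a word -/

/-- The letter `x` occurs before the letter `y` in the word `w`. -/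
def Bef (w : List ℕ) (x y : ℕ) : Prop := [x, y].Sublist w

theorem not_bef_nil {x y : ℕ} : ¬ Bef [] x y := by simp [Bef]

theorem bef_cons {s : ℕ} {v : List ℕ} {x y : ℕ} :
    Bef (s :: v) x y ↔ (x = s ∧ y ∈ v) ∨ Bef v x y := by
  rw [Bef, List.cons_sublist_cons', List.singleton_sublist, or_comm]; rfl

theorem bef_append {u v : List ℕ} {x y : ℕ} :
    Bef (u ++ v) x y ↔ Bef u x y ∨ Bef v x y ∨ (x ∈ u ∧ y ∈ v) := by
  induction u with
  | nil => simp [not_bef_nil]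
  | cons a u ih =>
    simp only [List.cons_append, bef_cons, ih, List.mem_append, List.mem_cons]
    tauto

theorem Bef.mem_left {w : List ℕ} {x y : ℕ} (h : Bef w x y) : x ∈ w := h.subset (by simp)

theorem Bef.mem_right {w : List ℕ} {x y : ℕ} (h : Bef w x y) : y ∈ w := h.subset (by simp)

theorem Bef.trans {w : List ℕ} (hw : w.Nodup) {x y z : ℕ} (h : Bef w x y) (h' : Bef w y z) :
    Bef w x z := by
  induction w with
  | nil => exact absurd h not_bef_nil
  | cons a w ih =>
    rw [List.nodup_cons] at hw
    rw [bef_cons] at *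
    rcases h with ⟨rfl, h⟩ | h
    · rcases h' with ⟨rfl, h'⟩ | h'
      · exact absurd h hw.1
      · exact .inl ⟨rfl, h'.mem_right⟩
    · rcases h' with ⟨rfl, h'⟩ | h'
      · exact absurd h.mem_right hw.1
      · exact .inr (ih hw.2 h h')

theorem Bef.irrefl {w : List ℕ} (hw : w.Nodup) {x : ℕ} : ¬ Bef w x x := fun h => by
  simpa using hw.sublist h

theorem Bef.asymm {w : List ℕ} (hw : w.Nodup) {x y : ℕ} (h : Bef w x y) : ¬ Bef w y x :=
  fun h' => Bef.irrefl hw (h.trans hw h')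

theorem bef_or_bef {w : List ℕ} {x y : ℕ} (hx : x ∈ w) (hy : y ∈ w) (hxy : x ≠ y) :
    Bef w x y ∨ Bef w y x := by
  induction w with
  | nil => simp at hx
  | cons a w ih =>
    simp only [bef_cons]
    rcases List.mem_cons.1 hx with rfl | hx
    · exact .inl (.inl ⟨rfl, (List.mem_cons.1 hy).resolve_left hxy.symm⟩)
    · rcases List.mem_cons.1 hy with h | hy
      · exact .inr (.inl ⟨h, hx⟩)
      · have := ih hx hy
        tauto

/-! ### The effect of stack-sorting on the order of the letters -/

theorem stackSort_nil : stackSort [] = [] := by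
  rw [stackSort]; rfl

theorem stackSort_append_cons {L R : List ℕ} {m : ℕ} (hL : ∀ x ∈ L, x < m)
    (hR : ∀ x ∈ R, x < m) :
    stackSort (L ++ m :: R) = stackSort L ++ stackSort R ++ [m] := by
  have hmax : (L ++ m :: R).max? = some m := by
    rw [List.max?_eq_some_iff]
    refine ⟨by simp, fun x hx => ?_⟩
    simp only [List.mem_append, List.mem_cons] at hx
    rcases hx with hx | rfl | hx
    exacts [(hL x hx).le, le_rfl, (hR x hx).le]
  have hidx : (L ++ m :: R).idxOf m = L.length := by
    rw [List.idxOf_append_of_notMem fun h => (hL m h).false]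
    simp
  rw [stackSort]
  split
  · simp_all
  · rename_i m' h
    obtain rfl : m = m' := by simpa [hmax] using h
    have hdrop : (L ++ m :: R).drop (L.length + 1) = R := by simp [List.drop_append]
    simp [hidx, hdrop]

theorem exists_eq_append_max_cons {w : List ℕ} (hw : w.Nodup) (h0 : w ≠ []) :
    ∃ L m R, w = L ++ m :: R ∧ (∀ x ∈ L, x < m) ∧ ∀ x ∈ R, x < m := by
  obtain ⟨m, hm⟩ : ∃ m, w.max? = some m := by
    cases h : w.max? with
    | none => exact absurd (List.max?_eq_none_iff.1 h) h0
    | some m => exact ⟨m, rfl⟩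
  obtain ⟨hmem, hle⟩ := List.max?_eq_some_iff.1 hm
  obtain ⟨L, R, rfl⟩ := List.append_of_mem hmem
  have hnd := List.nodup_middle.1 hw
  rw [List.nodup_cons] at hnd
  refine ⟨L, m, R, rfl, fun x hx => lt_of_le_of_ne (hle x (by simp [hx])) ?_,
    fun x hx => lt_of_le_of_ne (hle x (by simp [hx])) ?_⟩
  · rintro rfl; exact hnd.1 (by simp [hx])
  · rintro rfl; exact hnd.1 (by simp [hx])

/-- Induction over a word without repeated letters by splitting at the largest letter. -/
theorem nodup_max_induction {P : List ℕ → Prop} (nil : P [])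
    (step : ∀ L m R, (L ++ m :: R).Nodup → (∀ x ∈ L, x < m) → (∀ x ∈ R, x < m) → P L → P R →
      P (L ++ m :: R)) : ∀ w : List ℕ, w.Nodup → P w
  | w, hw => by
    by_cases h0 : w = []
    · exact h0 ▸ nil
    · obtain ⟨L, m, R, rfl, hL, hR⟩ := exists_eq_append_max_cons hw h0
      exact step L m R hw hL hR
        (nodup_max_induction nil step L (List.nodup_append.1 hw).1)
        (nodup_max_induction nil step R (List.nodup_cons.1 (List.nodup_append.1 hw).2.1).2)
termination_by w => w.length
decreasing_by all_goals subst_vars; simp only [List.length_append, List.length_cons]; omega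

theorem stackSort_perm {w : List ℕ} (hw : w.Nodup) : (stackSort w).Perm w := by
  revert hw
  refine nodup_max_induction (P := fun w => (stackSort w).Perm w) (by rw [stackSort_nil])
    (fun L m R _ hL hR ihL ihR => ?_) w
  rw [stackSort_append_cons hL hR, List.append_assoc]
  exact ihL.append ((ihR.append_right [m]).trans List.perm_append_comm)

theorem nodup_stackSort {w : List ℕ} (hw : w.Nodup) : (stackSort w).Nodup :=
  (stackSort_perm hw).nodup_iff.2 hw

/-- An inversion survives the stack-sorting operation if and only if there is a letter between
that is larger than both. -/
theorem bef_stackSort_iff {w : List ℕ} (hw : w.Nodup) {a b : ℕ} (hab : b < a) :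
    Bef (stackSort w) a b ↔ ∃ c, a < c ∧ Bef w a c ∧ Bef w c b := by
  revert hw
  refine nodup_max_induction (P := fun w => Bef (stackSort w) a b ↔
    ∃ c, a < c ∧ Bef w a c ∧ Bef w c b) (by simp [stackSort_nil, not_bef_nil])
    (fun L m R hnd hL hR ihL ihR => ?_) w
  have hLn := (List.nodup_append.1 hnd).1
  have hRn := (List.nodup_cons.1 (List.nodup_append.1 hnd).2.1).2
  have hdis := (List.nodup_append.1 hnd).2.2
  rw [stackSort_append_cons hL hR]
  simp only [bef_append, bef_cons, ihL, ihR, (stackSort_perm hLn).mem_iff,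
    (stackSort_perm hRn).mem_iff, List.mem_append, List.mem_cons, not_bef_nil,
    List.not_mem_nil, and_false, or_false, false_or]
  constructor
  · rintro ((⟨c, h1, h2, h3⟩ | ⟨c, h1, h2, h3⟩ | ⟨h1, h2⟩) | ⟨h1, rfl⟩)
    · exact ⟨c, h1, .inl h2, .inl h3⟩
    · exact ⟨c, h1, .inr (.inl (.inr h2)), .inr (.inl (.inr h3))⟩
    -- A pair with `a` in `L` and `b` in `R` keeps its order because the maximum `m` separates it.
    · exact ⟨m, hL a h1, .inr (.inr ⟨h1, .inl rfl⟩), .inr (.inl (.inl ⟨rfl, h2⟩))⟩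
    · rcases h1 with h1 | h1
      · exact absurd (hL a h1) (by omega)
      · exact absurd (hR a h1) (by omega)
  · rintro ⟨c, hac, h1, h2⟩
    left
    rcases h1 with h1 | (⟨rfl, h1⟩ | h1) | ⟨h1, hc⟩
    · have ha := hL a h1.mem_left
      rcases h2 with h2 | (⟨rfl, h2⟩ | h2) | ⟨h2, rfl | h3⟩
      · exact .inl ⟨c, hac, h1, h2⟩
      · exact .inr (.inr ⟨h1.mem_left, h2⟩)
      · exact .inr (.inr ⟨h1.mem_left, h2.mem_right⟩)
      · omega
      · exact .inr (.inr ⟨h1.mem_left, h3⟩)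
    · exact absurd (hR c h1) (by omega)
    · rcases h2 with h2 | (⟨rfl, h2⟩ | h2) | ⟨h2, -⟩
      · exact absurd rfl (hdis c h2.mem_left c (by simp [h1.mem_right]))
      · exact absurd (hR c h1.mem_right) (by omega)
      · exact .inr (.inl ⟨c, hac, h1, h2⟩)
      · exact absurd rfl (hdis c h2 c (by simp [h1.mem_right]))
    · have ha := hL a h1
      rcases h2 with h2 | (⟨rfl, h2⟩ | h2) | ⟨h2, rfl | h3⟩
      · exact absurd rfl (hdis c h2.mem_left c (by simpa using hc))
      · exact .inr (.inr ⟨h1, h2⟩)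
      · exact .inr (.inr ⟨h1, h2.mem_right⟩)
      · omega
      · exact .inr (.inr ⟨h1, h3⟩)

/-- A pair of letters in the correct order is not interchanged by the stack-sorting operation. -/
theorem Bef.stackSort {w : List ℕ} (hw : w.Nodup) {a b : ℕ} (hab : a < b) (h : Bef w a b) :
    Bef (stackSort w) a b := by
  refine (bef_or_bef ((stackSort_perm hw).mem_iff.2 h.mem_left)
    ((stackSort_perm hw).mem_iff.2 h.mem_right) hab.ne).resolve_right fun h' => ?_
  obtain ⟨c, -, h1, h2⟩ := (bef_stackSort_iff hw hab).1 h'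
  exact h.asymm hw (h1.trans hw h2)

/-- `w` avoids the pattern `3241`. -/
def Avoids3241 (w : List ℕ) : Prop :=
  ∀ a b c d, Bef w a b → Bef w b c → Bef w c d → d < b → b < a → a < c → False

/-- Let a b c d form 3241 in the sorted word. The inversions ab and cd come from `w`, with some e >
a and f > c inside them. If b precedes c in `w`, the pattern was there already. Otherwise the
inversion cb was removed, so f cannot lie between c and b; it follows b, and a b f d is a 3241 in
`w`. -/
theorem Avoids3241.stackSort {w : List ℕ} (hw : w.Nodup) (h : Avoids3241 w) :
    Avoids3241 (stackSort w) := by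
  intro a b c d hab hbc hcd h1 h2 h3
  obtain ⟨e, he, hae, heb⟩ := (bef_stackSort_iff hw h2).1 hab
  obtain ⟨f, hf, hcf, hfd⟩ := (bef_stackSort_iff hw (h1.trans (h2.trans h3))).1 hcd
  have hab' := hae.trans hw heb
  rcases bef_or_bef ((stackSort_perm hw).mem_iff.1 hbc.mem_left)
    ((stackSort_perm hw).mem_iff.1 hbc.mem_right) (h2.trans h3).ne with hbc' | hcb'
  · exact h a b c d hab' hbc' (hcf.trans hw hfd) h1 h2 h3
  · rcases bef_or_bef hab'.mem_right hcf.mem_right (by omega : b ≠ f) with hbf | hfb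
    · exact h a b f d hab' hbf hfd h1 h2 (h3.trans hf)
    · exact hbc.asymm (nodup_stackSort hw)
        ((bef_stackSort_iff hw (h2.trans h3)).2 ⟨f, hf, hcf, hfb⟩)

/-- There is an increasing subsequence `a < a' < ⋯` of `k + 1` letters of `w` that satisfy `p`. -/
def Asc (w : List ℕ) (p : ℕ → Prop) : ℕ → ℕ → Prop
  | 0, a => p a
  | k + 1, a => p a ∧ ∃ a', a < a' ∧ Bef w a a' ∧ Asc w p k a'

theorem Asc.head {w : List ℕ} {p : ℕ → Prop} {k a : ℕ} (h : Asc w p k a) : p a := by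
  cases k with
  | zero => exact h
  | succ k => exact h.1

/-- `w` contains the pattern `2 3 ⋯ (k + 2) 1`, where `b` and `a` play the roles of `1` and `2`. -/
def AscBefore (w : List ℕ) (b k a : ℕ) : Prop := Asc w (fun x => b < x ∧ Bef w x b) k a

/-- Under stack-sorting, an increasing sequence before a smaller letter loses its last element. -/
theorem AscBefore.stackSort {w : List ℕ} (hw : w.Nodup) {b k a : ℕ}
    (h : AscBefore w b (k + 1) a) : AscBefore (stackSort w) b k a := by
  -- The next letter `y` of the sequence is larger than `x` and lies between `x` and `b`, so it
  -- protects the inversion of `x` and `b`.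
  have hp : ∀ x y, x < y → Bef w x y → (b < x ∧ Bef w x b) → (b < y ∧ Bef w y b) →
      (b < x ∧ Bef (StackSort.stackSort w) x b) := fun x y hxy h1 h2 h3 =>
    ⟨h2.1, (bef_stackSort_iff hw h2.1).2 ⟨y, hxy, h1, h3.2⟩⟩
  induction k generalizing a with
  | zero =>
    obtain ⟨h1, a', h2, h3, h4⟩ := h
    exact hp a a' h2 h3 h1 h4
  | succ k ih =>
    obtain ⟨h1, a', h2, h3, h4⟩ := h
    exact ⟨hp a a' h2 h3 h1 h4.head, a', h2, h3.stackSort hw h2, ih h4⟩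

/-- The last letter still precedes `b` after sorting, so in `w` a larger letter lies between them
and prolongs the sequence. It remains to see that consecutive letters a < a' were already in this
order in `w`. If a' came first, take d > a' between a' and b: after a it gives the 3241 pattern a' a
d b, and before a it would have preserved the inversion a'a. -/
theorem AscBefore.of_stackSort {w : List ℕ} (hw : w.Nodup) (h3241 : Avoids3241 w) {b k a : ℕ}
    (h : AscBefore (StackSort.stackSort w) b k a) : AscBefore w b (k + 1) a := by
  induction k generalizing a with
  | zero =>
    obtain ⟨h1, h2⟩ := h
    obtain ⟨c, hac, h3, h4⟩ := (bef_stackSort_iff hw h1).1 h2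
    exact ⟨⟨h1, h3.trans hw h4⟩, c, hac, h3, h1.trans hac, h4⟩
  | succ k ih =>
    obtain ⟨⟨h1, h2⟩, a', haa', h3, h4⟩ := h
    obtain ⟨c, hac, hac', hcb⟩ := (bef_stackSort_iff hw h1).1 h2
    obtain ⟨h5, h6⟩ := h4.head
    obtain ⟨d, had, had', hdb⟩ := (bef_stackSort_iff hw h5).1 h6
    refine ⟨⟨h1, hac'.trans hw hcb⟩, a', haa', ?_, ih h4⟩
    refine (bef_or_bef ((stackSort_perm hw).mem_iff.1 h3.mem_left)
      ((stackSort_perm hw).mem_iff.1 h3.mem_right) haa'.ne).resolve_right fun h7 => ?_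
    rcases bef_or_bef hac'.mem_left had'.mem_right (haa'.trans had).ne with h8 | h8
    · exact h3241 a' a d b h7 h8 hdb h1 haa' had
    · exact h3.asymm (nodup_stackSort hw) ((bef_stackSort_iff hw haa').2 ⟨d, had, had', h8⟩)

/-- A word that avoids `3241` is sorted by `t` applications of the stack-sorting operation if and
only if it avoids `2 3 ⋯ (t + 2) 1`. -/
theorem iterate_stackSort_eq_range_iff {n t : ℕ} {w : List ℕ} (hw : w.Perm (List.range n))
    (h : Avoids3241 w) :
    StackSort.stackSort^[t] w = List.range n ↔ ¬ ∃ b a, AscBefore w b t a := by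
  have hnd : w.Nodup := hw.nodup_iff.2 List.nodup_range
  induction t generalizing w with
  | zero =>
    simp only [Function.iterate_zero, id_eq, not_exists]
    constructor
    · rintro rfl b a ⟨h1, h2⟩
      have := List.pairwise_iff_forall_sublist.1 List.pairwise_lt_range h2
      omega
    · intro h'
      refine hw.eq_of_pairwise (le := (· < ·)) (by intro a b _ _ _ _; omega)
        (List.pairwise_iff_forall_sublist.2 fun {a b} hab => ?_) List.pairwise_lt_range
      have hne : a ≠ b := by rintro rfl; exact Bef.irrefl hnd hab
      exact lt_of_le_of_ne (not_lt.1 fun hlt => h' b a ⟨hlt, hab⟩) hne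
  | succ t ih =>
    rw [Function.iterate_succ_apply]
    refine (ih ((stackSort_perm hnd).trans hw) (h.stackSort hnd) (nodup_stackSort hnd)).trans ?_
    exact not_congr (exists_congr fun b => exists_congr fun a =>
      ⟨fun h' => h'.of_stackSort hnd h, fun h' => h'.stackSort hnd⟩)

/-! ### One-line notation -/

theorem bef_ofFn {n : ℕ} {f : Fin n → ℕ} {x y : ℕ} :
    Bef (List.ofFn f) x y ↔ ∃ i j : Fin n, i < j ∧ f i = x ∧ f j = y := by
  induction n with
  | zero => simp [not_bef_nil]
  | succ n ih =>
    simp only [List.ofFn_succ, bef_cons, ih, List.mem_ofFn', Set.mem_range]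
    constructor
    · rintro (⟨rfl, j, rfl⟩ | ⟨i, j, hij, rfl, rfl⟩)
      · exact ⟨0, j.succ, Fin.succ_pos j, rfl, rfl⟩
      · exact ⟨i.succ, j.succ, Fin.succ_lt_succ_iff.2 hij, rfl, rfl⟩
    · rintro ⟨i, j, hij, rfl, rfl⟩
      obtain ⟨j, rfl⟩ := Fin.exists_succ_eq.2 (Fin.ne_zero_of_lt hij)
      rcases Fin.eq_zero_or_eq_succ i with rfl | ⟨i, rfl⟩
      · exact .inl ⟨rfl, j, rfl⟩
      · exact .inr ⟨i, j, Fin.succ_lt_succ_iff.1 hij, rfl, rfl⟩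

theorem bef_oneLine_iff {n : ℕ} {π : Equiv.Perm (Fin n)} {x y : ℕ} :
    Bef (oneLine π) x y ↔ ∃ i j : Fin n, i < j ∧ (π i : ℕ) = x ∧ (π j : ℕ) = y := bef_ofFn

theorem bef_oneLine {n : ℕ} {π : Equiv.Perm (Fin n)} {i j : Fin n} :
    Bef (oneLine π) (π i) (π j) ↔ i < j := by
  rw [bef_oneLine_iff]
  constructor
  · rintro ⟨i', j', h, h1, h2⟩
    rwa [π.injective (Fin.ext h1), π.injective (Fin.ext h2)] at h
  · exact fun h => ⟨i, j, h, rfl, rfl⟩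

theorem mem_oneLine {n : ℕ} {π : Equiv.Perm (Fin n)} {x : ℕ} :
    x ∈ oneLine π ↔ ∃ i : Fin n, (π i : ℕ) = x := by
  simp [oneLine, List.mem_ofFn']

theorem nodup_oneLine {n : ℕ} (π : Equiv.Perm (Fin n)) : (oneLine π).Nodup :=
  List.nodup_ofFn.2 (Fin.val_injective.comp π.injective)

theorem length_oneLine {n : ℕ} (π : Equiv.Perm (Fin n)) : (oneLine π).length = n := by
  simp [oneLine]

theorem oneLine_perm_range {n : ℕ} (π : Equiv.Perm (Fin n)) :
    (oneLine π).Perm (List.range n) := by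
  rw [List.perm_ext_iff_of_nodup (nodup_oneLine π) List.nodup_range]
  intro x
  rw [mem_oneLine, List.mem_range]
  exact ⟨fun ⟨i, hi⟩ => hi ▸ (π i).2, fun hx => ⟨π.symm ⟨x, hx⟩, by simp⟩⟩

theorem oneLine_injective {n : ℕ} : Function.Injective (oneLine (n := n)) := fun _ _ h =>
  Equiv.ext fun i => Fin.ext (congrFun (List.ofFn_injective h) i)

/-- Statistics count positions, while the recursion over trees cuts words into pieces; this passes
from one to the other. -/
theorem card_filter_eq_countP_oneLine {n : ℕ} (π : Equiv.Perm (Fin n)) (P : Fin n → Prop)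
    [DecidablePred P] (Q : ℕ → Prop) [DecidablePred Q] (h : ∀ i, P i ↔ Q (π i)) :
    (Finset.univ.filter P).card = (oneLine π).countP (fun x => decide (Q x)) := by
  have : (fun x => decide (Q x)) ∘ (fun i : Fin n => (π i : ℕ)) = fun i => decide (P i) := by
    funext i
    simp [h]
  rw [oneLine, List.ofFn_eq_map, List.countP_map, this, List.countP_eq_length_filter]
  rfl

theorem sum_eq_sum_map_oneLine {n : ℕ} (π : Equiv.Perm (Fin n)) (f : ℕ → ℕ) :
    ∑ i, f (π i) = ((oneLine π).map f).sum := by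
  rw [oneLine, List.map_ofFn, List.sum_ofFn]
  rfl

/-! ### The words of the naturally labeled binary trees -/

/-- The in-order word of the natural labeling of `T` with labels `s, s + 1, …`. -/
def treeWord (s : ℕ) (T : BinaryTree Unit) : List ℕ := inorderWord (naturalLabeling s T)

@[simp] theorem treeWord_nil (s : ℕ) : treeWord s .nil = [] := rfl

theorem treeWord_node (s : ℕ) (a : Unit) (l r : BinaryTree Unit) :
    treeWord s (.node a l r) = treeWord (s + 1 + r.numNodes) l ++ s :: treeWord (s + 1) r := rfl

theorem mem_treeWord {s : ℕ} {T : BinaryTree Unit} {x : ℕ} :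
    x ∈ treeWord s T ↔ s ≤ x ∧ x < s + T.numNodes := by
  rw [treeWord, (perm_inorderWord T s).mem_iff, List.mem_range'_1]

theorem nodup_treeWord (s : ℕ) (T : BinaryTree Unit) : (treeWord s T).Nodup :=
  (perm_inorderWord T s).nodup_iff.2 List.nodup_range'

theorem length_treeWord (s : ℕ) (T : BinaryTree Unit) : (treeWord s T).length = T.numNodes := by
  rw [treeWord, (perm_inorderWord T s).length_eq, List.length_range']

theorem oneLine_lambdaInv {n : ℕ} (T : BinTree n) : oneLine (lambdaInv T) = treeWord 0 T.1 :=
  List.ext_getElem (by rw [length_oneLine, length_treeWord, T.2]) fun i h1 h2 => by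
    simp [oneLine, lambdaInv, treeWord]

/-- The word `w = L s R` splits at its least letter `s` such that all letters of `L` are larger
than those of `R`. -/
structure IsSplit (w L : List ℕ) (s : ℕ) (R : List ℕ) : Prop where
  eq : w = L ++ s :: R
  nodup : w.Nodup
  root_lt_left : ∀ x ∈ L, s < x
  root_lt_right : ∀ x ∈ R, s < x
  right_lt_left : ∀ x ∈ L, ∀ y ∈ R, y < x

theorem isSplit_treeWord (s : ℕ) (a : Unit) (l r : BinaryTree Unit) :
    IsSplit (treeWord s (.node a l r)) (treeWord (s + 1 + r.numNodes) l) s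
      (treeWord (s + 1) r) where
  eq := treeWord_node s a l r
  nodup := nodup_treeWord _ _
  root_lt_left x hx := by rw [mem_treeWord] at hx; omega
  root_lt_right x hx := by rw [mem_treeWord] at hx; omega
  right_lt_left x hx y hy := by rw [mem_treeWord] at hx hy; omega

namespace IsSplit

variable {w L R : List ℕ} {s : ℕ}

theorem mem_iff (h : IsSplit w L s R) {x : ℕ} : x ∈ w ↔ x ∈ L ∨ x = s ∨ x ∈ R := by
  simp [h.eq]

theorem bef_iff (h : IsSplit w L s R) {x y : ℕ} : Bef w x y ↔
    Bef L x y ∨ ((x = s ∧ y ∈ R) ∨ Bef R x y) ∨ (x ∈ L ∧ (y = s ∨ y ∈ R)) := by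
  rw [h.eq, bef_append, bef_cons, List.mem_cons]

theorem bef_left_iff (h : IsSplit w L s R) {x y : ℕ} (hx : x ∈ L) :
    Bef w x y ↔ Bef L x y ∨ y = s ∨ y ∈ R := by
  rw [h.bef_iff]
  constructor
  · rintro (h1 | (⟨rfl, h1⟩ | h1) | ⟨h1, h2⟩)
    · exact .inl h1
    · exact absurd (h.root_lt_left x hx) (lt_irrefl _)
    · exact absurd (h.right_lt_left x hx x h1.mem_left) (lt_irrefl _)
    · exact .inr h2
  · rintro (h1 | h1)
    · exact .inl h1
    · exact .inr (.inr ⟨hx, h1⟩)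

theorem bef_root_iff (h : IsSplit w L s R) {y : ℕ} : Bef w s y ↔ y ∈ R := by
  rw [h.bef_iff]
  constructor
  · rintro (h1 | (⟨-, h1⟩ | h1) | ⟨h1, -⟩)
    · exact absurd (h.root_lt_left s h1.mem_left) (lt_irrefl _)
    · exact h1
    · exact absurd (h.root_lt_right s h1.mem_left) (lt_irrefl _)
    · exact absurd (h.root_lt_left s h1) (lt_irrefl _)
  · exact fun h1 => .inr (.inl (.inl ⟨rfl, h1⟩))

theorem bef_right_iff (h : IsSplit w L s R) {x y : ℕ} (hx : x ∈ R) :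
    Bef w x y ↔ Bef R x y := by
  rw [h.bef_iff]
  constructor
  · rintro (h1 | (⟨rfl, -⟩ | h1) | ⟨h1, -⟩)
    · exact absurd (h.right_lt_left x h1.mem_left x hx) (lt_irrefl _)
    · exact absurd (h.root_lt_right x hx) (lt_irrefl _)
    · exact h1
    · exact absurd (h.right_lt_left x h1 x hx) (lt_irrefl _)
  · exact fun h1 => .inr (.inl (.inr h1))

theorem bef_to_left_iff (h : IsSplit w L s R) {x y : ℕ} (hy : y ∈ L) :
    Bef w x y ↔ Bef L x y := by
  rw [h.bef_iff]
  constructor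
  · rintro (h1 | (⟨-, h1⟩ | h1) | ⟨-, rfl | h1⟩)
    · exact h1
    · exact absurd (h.right_lt_left y hy y h1) (lt_irrefl _)
    · exact absurd (h.right_lt_left y hy y h1.mem_right) (lt_irrefl _)
    · exact absurd (h.root_lt_left y hy) (lt_irrefl _)
    · exact absurd (h.right_lt_left y hy y h1) (lt_irrefl _)
  · exact .inl

theorem bef_to_root_iff (h : IsSplit w L s R) {x : ℕ} : Bef w x s ↔ x ∈ L := by
  rw [h.bef_iff]
  constructor
  · rintro (h1 | (⟨-, h1⟩ | h1) | ⟨h1, -⟩)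
    · exact h1.mem_left
    · exact absurd (h.root_lt_right s h1) (lt_irrefl _)
    · exact absurd (h.root_lt_right s h1.mem_right) (lt_irrefl _)
    · exact h1
  · exact fun h1 => .inr (.inr ⟨h1, .inl rfl⟩)

theorem le_of_mem (h : IsSplit w L s R) {x : ℕ} (hx : x ∈ w) : s ≤ x := by
  rcases h.mem_iff.1 hx with h1 | rfl | h1
  exacts [(h.root_lt_left x h1).le, le_rfl, (h.root_lt_right x h1).le]

end IsSplit

/-! ### The permutations that avoid `213` -/

/-- `w` avoids the pattern `213`. -/
def Avoids213 (w : List ℕ) : Prop :=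
  ∀ x y z, Bef w x y → Bef w y z → y < x → x < z → False

/-- The last letter z of a 213 decides: if it lies in L, so does the whole pattern; if it lies in R,
the first letter is smaller than z and not the minimum, hence also lies in R. -/
theorem avoids213_treeWord (s : ℕ) (T : BinaryTree Unit) : Avoids213 (treeWord s T) := by
  induction T generalizing s with
  | nil => exact fun x y z h => absurd h not_bef_nil
  | node a l r ihl ihr =>
    intro x y z hxy hyz h1 h2
    have h := isSplit_treeWord s a l r
    rcases h.mem_iff.1 hyz.mem_right with hz | rfl | hz
    · rw [h.bef_to_left_iff hz] at hyz
      rw [h.bef_to_left_iff hyz.mem_left] at hxy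
      exact ihl _ x y z hxy hyz h1 h2
    · exact absurd (h.le_of_mem hxy.mem_left) (by omega)
    · rcases h.mem_iff.1 hxy.mem_left with hx | rfl | hx
      · exact absurd (h.right_lt_left x hx z hz) (by omega)
      · exact absurd (h.le_of_mem hxy.mem_right) (by omega)
      · rw [h.bef_right_iff hx] at hxy
        rw [h.bef_right_iff hxy.mem_right] at hyz
        exact ihr _ x y z hxy hyz h1 h2

theorem treeWord_injective {s : ℕ} {T T' : BinaryTree Unit} (h : treeWord s T = treeWord s T') :
    T = T' := by
  induction T generalizing s T' with
  | nil =>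
    cases T' with
    | nil => rfl
    | node a l r => simp [treeWord_node] at h
  | node a l r ihl ihr =>
    cases T' with
    | nil => simp [treeWord_node] at h
    | node a' l' r' =>
      have h1 := isSplit_treeWord s a l r
      have h2 := isSplit_treeWord s a' l' r'
      rw [treeWord_node, treeWord_node, List.append_cons_inj_of_notMem] at h
      · obtain ⟨hl, -, hr⟩ := h
        -- The right subtrees must be identified first, since their size fixes the first label of
        -- the left subtrees.
        obtain rfl := ihr hr
        obtain rfl := ihl hl
        rfl
      · exact fun h => absurd (h1.root_lt_left s h) (lt_irrefl _)
      · exact fun h => absurd (h1.root_lt_right s h) (lt_irrefl _)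

/-- Every word with the letters `s, s + 1, …` that avoids `213` is the word of a binary tree. -/
theorem exists_treeWord_eq {s : ℕ} : ∀ {w : List ℕ}, w.Nodup →
    (∀ x, x ∈ w ↔ s ≤ x ∧ x < s + w.length) → Avoids213 w → ∃ T, treeWord s T = w := by
  intro w
  induction hk : w.length using Nat.strong_induction_on generalizing w s with
  | _ k ih =>
    subst hk
    intro hnd hmem hav
    rcases Nat.eq_zero_or_pos w.length with h0 | h0
    · exact ⟨.nil, (List.length_eq_zero_iff.1 h0).symm⟩
    obtain ⟨L, R, rfl⟩ := List.append_of_mem ((hmem s).2 ⟨le_rfl, by omega⟩)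
    obtain ⟨hLn, hsRn, hdis⟩ := List.nodup_append.1 hnd
    obtain ⟨hsR, hRn⟩ := List.nodup_cons.1 hsRn
    have hL : ∀ x ∈ L, s < x := fun x hx => lt_of_le_of_ne ((hmem x).1 (by simp [hx])).1
      fun h => hdis x hx s (by simp) h.symm
    have hR : ∀ x ∈ R, s < x := fun x hx => lt_of_le_of_ne ((hmem x).1 (by simp [hx])).1
      fun h => hsR (h ▸ hx)
    -- Otherwise x s y would be a 213.
    have hRL : ∀ x ∈ L, ∀ y ∈ R, y < x := fun x hx y hy => by
      by_contra hlt
      have hne := hdis x hx y (by simp [hy])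
      refine hav x s y ?_ ?_ (hL x hx) (by omega)
      · rw [bef_append]; exact .inr (.inr ⟨hx, by simp⟩)
      · rw [bef_append, bef_cons]; exact .inr (.inl (.inl ⟨rfl, hy⟩))
    simp only [List.length_append, List.length_cons, List.mem_append, List.mem_cons] at hmem ih
    -- All of s + 1, …, x must lie in `R`, because letters of `L` exceed x; counting bounds x.
    have hR' : ∀ x ∈ R, x < s + 1 + R.length := fun x hx => by
      have hsub : Finset.Icc (s + 1) x ⊆ R.toFinset := fun y hy => by
        rw [Finset.mem_Icc] at hy
        have hxw := (hmem x).1 (.inr (.inr hx))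
        rcases (hmem y).2 ⟨by omega, by omega⟩ with h | h | h
        · exact absurd (hRL y h x hx) (by omega)
        · omega
        · simpa using h
      have := Finset.card_le_card hsub
      rw [Nat.card_Icc, List.toFinset_card_of_nodup hRn] at this
      omega
    have hL' : ∀ x ∈ L, s + 1 + R.length ≤ x := fun x hx => by
      have hsub : R.toFinset ⊆ Finset.Ico (s + 1) x := fun y hy => by
        rw [List.mem_toFinset] at hy
        exact Finset.mem_Ico.2 ⟨hR y hy, hRL x hx y hy⟩
      have := Finset.card_le_card hsub
      rw [Nat.card_Ico, List.toFinset_card_of_nodup hRn] at this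
      have := hL x hx
      omega
    obtain ⟨r, hr⟩ := ih R.length (by omega) (w := R) (s := s + 1) rfl hRn
      (fun x => ⟨fun hx => ⟨hR x hx, hR' x hx⟩, fun hx => by
        rcases (hmem x).2 ⟨by omega, by omega⟩ with h | h | h
        · have := hL' x h; omega
        · omega
        · exact h⟩)
      (fun x y z h1 h2 => hav x y z (by rw [bef_append, bef_cons]; tauto)
        (by rw [bef_append, bef_cons]; tauto))
    obtain ⟨l, hl⟩ := ih L.length (by omega) (w := L) (s := s + 1 + R.length) rfl hLn
      (fun x => ⟨fun hx => ⟨hL' x hx, by have := (hmem x).1 (.inl hx); omega⟩, fun hx => by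
        rcases (hmem x).2 ⟨by omega, by omega⟩ with h | h | h
        · exact h
        · omega
        · have := hR' x h; omega⟩)
      (fun x y z h1 h2 => hav x y z (by rw [bef_append, bef_cons]; tauto)
        (by rw [bef_append, bef_cons]; tauto))
    refine ⟨.node () l r, ?_⟩
    rw [treeWord_node, ← length_treeWord (s + 1) r, hr, hl]

theorem mem_avoiders_213_iff {n : ℕ} {π : Equiv.Perm (Fin n)} :
    π ∈ avoiders n ![2, 1, 3] ↔ Avoids213 (oneLine π) := by
  rw [avoiders, Set.mem_ofPred_eq, not_iff_comm]
  simp only [Avoids213, not_forall]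
  constructor
  · rintro ⟨x, y, z, hxy, hyz, h1, h2, -⟩
    obtain ⟨i, j, hij, rfl, rfl⟩ := bef_oneLine_iff.1 hxy
    obtain ⟨k, rfl⟩ := mem_oneLine.1 hyz.mem_right
    rw [bef_oneLine] at hyz
    refine ⟨![i, j, k], ?_, ?_⟩
    · rw [Fin.strictMono_iff_lt_succ]
      intro a
      fin_cases a
      exacts [hij, hyz]
    · intro a b
      fin_cases a <;> fin_cases b <;> simp <;> omega
  · rintro ⟨f, hf, h⟩
    exact ⟨π (f 0), π (f 1), π (f 2), bef_oneLine.2 (hf (by decide)),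
      bef_oneLine.2 (hf (by decide)), (h 1 0).2 (by simp), (h 0 2).2 (by simp), id⟩

theorem lambdaInv_bijOn {n : ℕ} :
    Set.BijOn (lambdaInv (n := n)) Set.univ (avoiders n ![2, 1, 3]) := by
  refine ⟨fun T _ => ?_, fun T _ T' _ h => ?_, fun π hπ => ?_⟩
  · rw [mem_avoiders_213_iff, oneLine_lambdaInv]
    exact avoids213_treeWord _ _
  · have := congrArg oneLine h
    rw [oneLine_lambdaInv, oneLine_lambdaInv] at this
    exact Subtype.ext (treeWord_injective this)
  · rw [mem_avoiders_213_iff] at hπ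
    obtain ⟨T, hT⟩ := exists_treeWord_eq (s := 0) (nodup_oneLine π) (fun x => by
      rw [(oneLine_perm_range π).mem_iff, length_oneLine, List.mem_range]; omega) hπ
    refine ⟨⟨T, ?_⟩, trivial, oneLine_injective ?_⟩
    · rw [← length_treeWord 0 T, hT, length_oneLine]
    · rw [oneLine_lambdaInv, hT]

/-! ### Stack-sortable words of trees -/

/-- Transfers increasing sequences between a word and its parts; `C` is a set of letters that no
ascent of `w` leaves. -/
theorem Asc.imp {w w' : List ℕ} {p q C : ℕ → Prop}
    (hC : ∀ x y, C x → x < y → Bef w x y → C y ∧ Bef w' x y) (hp : ∀ x, C x → p x → q x)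
    {k a : ℕ} (ha : C a) (h : Asc w p k a) : Asc w' q k a := by
  induction k generalizing a with
  | zero => exact hp a ha h
  | succ k ih =>
    obtain ⟨h1, a', h2, h3, h4⟩ := h
    obtain ⟨h5, h6⟩ := hC a a' ha h2 h3
    exact ⟨hp a ha h1, a', h2, h6, ih h5 h4⟩

namespace IsSplit

variable {w L R : List ℕ} {s : ℕ}

/-- Every letter after `L` is smaller than every letter of `L`, so an increasing sequence cannot
leave `L`. -/
theorem left_closed (h : IsSplit w L s R) (x y : ℕ) (hx : x ∈ L) (hxy : x < y)
    (hb : Bef w x y) : y ∈ L ∧ Bef L x y := by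
  rcases (h.bef_left_iff hx).1 hb with h1 | rfl | h1
  · exact ⟨h1.mem_right, h1⟩
  · exact absurd (h.root_lt_left x hx) (by omega)
  · exact absurd (h.right_lt_left x hx y h1) (by omega)

theorem right_closed (h : IsSplit w L s R) (x y : ℕ) (hx : x ∈ R) (_ : x < y)
    (hb : Bef w x y) : y ∈ R ∧ Bef R x y := by
  rw [h.bef_right_iff hx] at hb
  exact ⟨hb.mem_right, hb⟩

theorem asc_left (h : IsSplit w L s R) {p : ℕ → Prop} (hp : ∀ x ∈ L, p x) {k a : ℕ}
    (ha : Asc L (· ∈ L) k a) : Asc w p k a :=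
  Asc.imp (C := (· ∈ L)) (fun _ _ _ _ hb => ⟨hb.mem_right, h.bef_iff.2 (.inl hb)⟩)
    (fun x hx _ => hp x hx) ha.head ha

end IsSplit

/-- The largest number of nodes of a path in `T` that goes to the right after each counted node. -/
def rightHeight : BinaryTree Unit → ℕ
  | .nil => 0
  | .node _ l r => max (rightHeight l) (rightHeight r + 1)

/-- The largest number of nodes of a path in `T` that goes to the left after each counted node. -/
def leftHeight : BinaryTree Unit → ℕ
  | .nil => 0
  | .node _ l r => max (leftHeight l + 1) (leftHeight r)

/-- The maximum of `rightHeight` over the left subtrees of the nodes on the right arm. -/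
def armRightHeight : BinaryTree Unit → ℕ
  | .nil => 0
  | .node _ l r => max (rightHeight l) (armRightHeight r)

theorem rightHeight_mirror (T : BinaryTree Unit) : rightHeight (mirror T) = leftHeight T := by
  induction T with
  | nil => rfl
  | node a l r hl hr => rw [mirror, rightHeight, leftHeight, hl, hr, max_comm]

/-- `leftHeight` also counts the arm node from which a path turns left, hence the shift by one.
Stated with `<`, it needs no exception for the empty tree. -/
theorem lt_armRightHeight_restrictedMirror_iff (T : BinaryTree Unit) (k : ℕ) :
    k < armRightHeight (restrictedMirror T) ↔ k + 1 < leftHeight T := by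
  induction T with
  | nil => simp [restrictedMirror, armRightHeight, leftHeight]
  | node a l r hl hr =>
    rw [restrictedMirror, armRightHeight, leftHeight, rightHeight_mirror, lt_max_iff, lt_max_iff,
      hr, Nat.add_lt_add_iff_right]

/-- An increasing subsequence that starts in L or R stays there; one that starts at the root
continues in R, which costs one step to the right. -/
theorem exists_asc_treeWord_iff {s k : ℕ} {T : BinaryTree Unit} :
    (∃ a, Asc (treeWord s T) (· ∈ treeWord s T) k a) ↔ k < rightHeight T := by
  induction T generalizing s k with
  | nil =>
    simp only [rightHeight, Nat.not_lt_zero, iff_false, not_exists]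
    exact fun a ha => by simpa using ha.head
  | node a l r ihl ihr =>
    have h := isSplit_treeWord s a l r
    set w := treeWord s (.node a l r)
    rw [rightHeight, lt_max_iff]
    constructor
    · rintro ⟨a, ha⟩
      rcases h.mem_iff.1 ha.head with h1 | rfl | h1
      · exact .inl (ihl.1 ⟨a, ha.imp h.left_closed (fun _ hx _ => hx) h1⟩)
      · right
        cases k with
        | zero => omega
        | succ k =>
          obtain ⟨-, a', h2, h3, h4⟩ := ha
          have := ihr.1 ⟨a', h4.imp h.right_closed (fun _ hx _ => hx) (h.bef_root_iff.1 h3)⟩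
          omega
      · have := ihr.1 ⟨a, ha.imp h.right_closed (fun _ hx _ => hx) h1⟩
        omega
    · rintro (h1 | h1)
      · obtain ⟨a, ha⟩ := (ihl (s := s + 1 + r.numNodes)).2 h1
        exact ⟨a, h.asc_left (fun x hx => h.mem_iff.2 (.inl hx)) ha⟩
      · cases k with
        | zero => exact ⟨s, h.mem_iff.2 (.inr (.inl rfl))⟩
        | succ k =>
          obtain ⟨a, ha⟩ := (ihr (s := s + 1) (k := k)).2 (by omega)
          refine ⟨s, h.mem_iff.2 (.inr (.inl rfl)), a, h.root_lt_right a ha.head,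
            h.bef_root_iff.2 ha.head, ?_⟩
          exact Asc.imp (C := (· ∈ treeWord (s + 1) r))
            (fun _ _ _ _ hb => ⟨hb.mem_right, h.bef_iff.2 (.inr (.inl (.inr hb)))⟩)
            (fun x hx _ => h.mem_iff.2 (.inr (.inr hx))) ha.head ha

/-- Every letter of L precedes the smaller letter `s`, so any increasing subsequence of L qualifies.
The minimum `s` cannot start a sequence, and a sequence starting in R lies there together with its
final smaller letter. -/
theorem exists_ascBefore_treeWord_iff {s k : ℕ} {T : BinaryTree Unit} :
    (∃ b a, AscBefore (treeWord s T) b k a) ↔ k < armRightHeight T := by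
  induction T generalizing s with
  | nil =>
    simp only [armRightHeight, Nat.not_lt_zero, iff_false, not_exists]
    exact fun b a ha => not_bef_nil ha.head.2
  | node a l r ihl ihr =>
    have h := isSplit_treeWord s a l r
    set w := treeWord s (.node a l r)
    rw [armRightHeight, lt_max_iff, ← ihr (s := s + 1),
      ← exists_asc_treeWord_iff (s := s + 1 + r.numNodes)]
    constructor
    · rintro ⟨b, a, ha⟩
      rcases h.mem_iff.1 ha.head.2.mem_left with h1 | rfl | h1
      · exact .inl ⟨a, ha.imp h.left_closed (fun _ hx _ => hx) h1⟩
      · exact absurd (h.le_of_mem ha.head.2.mem_right) (by have := ha.head.1; omega)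
      · exact .inr ⟨b, a, ha.imp h.right_closed
          (fun x hx hxb => ⟨hxb.1, (h.bef_right_iff hx).1 hxb.2⟩) h1⟩
    · rintro (⟨a, ha⟩ | ⟨b, a, ha⟩)
      · exact ⟨s, a, h.asc_left (fun x hx => ⟨h.root_lt_left x hx, h.bef_to_root_iff.2 hx⟩) ha⟩
      · exact ⟨b, a, ha.imp (C := fun _ => True)
          (fun _ _ _ _ hb => ⟨trivial, h.bef_iff.2 (.inr (.inl (.inr hb)))⟩)
          (fun x _ hx => ⟨hx.1, h.bef_iff.2 (.inr (.inl (.inr hx.2)))⟩) trivial⟩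

theorem Avoids213.avoids3241 {w : List ℕ} (h : Avoids213 w) : Avoids3241 w :=
  fun a b c _ hab hbc _ _ h2 h3 => h a b c hab hbc h2 h3

theorem isStackSortable_lambdaInv_iff {n t : ℕ} (T : BinTree n) :
    IsStackSortable t (lambdaInv T) ↔ armRightHeight T.1 ≤ t := by
  rw [IsStackSortable, iterate_stackSort_eq_range_iff (oneLine_perm_range _),
    oneLine_lambdaInv, exists_ascBefore_treeWord_iff, not_lt]
  rw [oneLine_lambdaInv]
  exact (avoids213_treeWord _ _).avoids3241

/-! ### Right-to-left minima of the words of trees -/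

/-- `x` is a right-to-left minimum of `w`. -/
def RlMin (w : List ℕ) (x : ℕ) : Prop := x ∈ w ∧ ∀ y, Bef w x y → x < y

/-- The number of nodes on the right arm. -/
def rightArm : BinaryTree Unit → ℕ
  | .nil => 0
  | .node _ _ r => rightArm r + 1

/-- The number of nodes on the left arm. -/
def leftArm : BinaryTree Unit → ℕ
  | .nil => 0
  | .node _ l _ => leftArm l + 1

theorem rightArm_mirror (T : BinaryTree Unit) : rightArm (mirror T) = leftArm T := by
  induction T with
  | nil => rfl
  | node a l r hl hr => rw [mirror, rightArm, leftArm, hl]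

theorem rightArm_restrictedMirror (T : BinaryTree Unit) :
    rightArm (restrictedMirror T) = rightArm T := by
  induction T with
  | nil => rfl
  | node a l r hl hr => rw [restrictedMirror, rightArm, rightArm, hr]

namespace IsSplit

variable {w L R : List ℕ} {s : ℕ}

theorem not_rlMin_left (h : IsSplit w L s R) {x : ℕ} (hx : x ∈ L) : ¬ RlMin w x := fun h' =>
  absurd (h'.2 s (h.bef_to_root_iff.2 hx)) (by have := h.root_lt_left x hx; omega)

theorem rlMin_root (h : IsSplit w L s R) : RlMin w s :=
  ⟨h.mem_iff.2 (.inr (.inl rfl)), fun y hy => h.root_lt_right y (h.bef_root_iff.1 hy)⟩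

theorem rlMin_right_iff (h : IsSplit w L s R) {x : ℕ} (hx : x ∈ R) : RlMin w x ↔ RlMin R x := by
  simp only [RlMin, hx, h.mem_iff, h.bef_right_iff hx, or_true]

end IsSplit

-- Letters of L are followed by the smaller `s`, the root is always a minimum, and nothing follows
-- R: the minima are the nodes of the right arm.
open Classical in
theorem countP_rlMin_treeWord (s : ℕ) (T : BinaryTree Unit) :
    (treeWord s T).countP (fun x => decide (RlMin (treeWord s T) x)) = rightArm T := by
  induction T generalizing s with
  | nil => rfl
  | node a l r ihl ihr =>
    have h := isSplit_treeWord s a l r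
    set w := treeWord s (.node a l r)
    rw [rightArm, ← ihr (s + 1), h.eq, List.countP_append, List.countP_cons, ← h.eq,
      List.countP_eq_zero.2 fun x hx => by simpa using h.not_rlMin_left hx,
      List.countP_congr (l := treeWord (s + 1) r)
        (q := fun x => decide (RlMin (treeWord (s + 1) r) x))
        fun x hx => by simpa using h.rlMin_right_iff hx]
    simp [h.rlMin_root]

theorem isRmi_iff {n : ℕ} {π : Equiv.Perm (Fin n)} {i : Fin n} :
    IsRmi π i ↔ RlMin (oneLine π) (π i) := by
  rw [IsRmi, RlMin, and_iff_right (mem_oneLine.2 ⟨i, rfl⟩)]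
  constructor
  · intro h y hy
    obtain ⟨j, rfl⟩ := mem_oneLine.1 hy.mem_right
    exact h j (bef_oneLine.1 hy)
  · exact fun h j hj => h _ (bef_oneLine.2 hj)

theorem rmi_lambdaInv {n : ℕ} (T : BinTree n) : rmi (lambdaInv T) = rightArm T.1 := by
  classical
  rw [← countP_rlMin_treeWord 0, ← oneLine_lambdaInv]
  exact card_filter_eq_countP_oneLine _ _ _ fun i => isRmi_iff

theorem rrmi_eq_countP {n : ℕ} [NeZero n] (π : Equiv.Perm (Fin n)) [DecidablePred fun x =>
      (x = 0 ∨ Bef (oneLine π) x 0) ∧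
        ∀ y, Bef (oneLine π) x y → Bef (oneLine π) y 0 → x < y] :
    rrmi π = (oneLine π).countP fun x => decide ((x = 0 ∨ Bef (oneLine π) x 0) ∧
      ∀ y, Bef (oneLine π) x y → Bef (oneLine π) y 0 → x < y) := by
  have h0 : ((π (π.symm 0) : Fin n) : ℕ) = 0 := by simp
  have hb : ∀ i : Fin n, Bef (oneLine π) (π i) 0 ↔ i < π.symm 0 := fun i => by
    rw [← bef_oneLine (π := π), h0]
  refine card_filter_eq_countP_oneLine _ _ _ fun i => and_congr ?_ ?_
  · rw [hb, pone, ← le_iff_eq_or_lt (a := i) |>.trans (or_congr_left ?_), Fin.le_def]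
    · omega
    · rw [← h0, ← Fin.ext_iff, π.injective.eq_iff]
  · constructor
    · intro h y hy hy0
      obtain ⟨j, rfl⟩ := mem_oneLine.1 hy.mem_right
      rw [hb, Fin.lt_def] at hy0
      exact h j (bef_oneLine.1 hy) (by rw [pone]; omega)
    · intro h j hj hj0
      refine h _ (bef_oneLine.2 hj) ((hb j).2 ?_)
      rw [pone] at hj0
      exact Fin.lt_def.2 (by omega)

/-- The letters before the least one form L, so the restricted minima are the right-to-left minima
of L and the least letter itself. -/
theorem rrmi_lambdaInv {n : ℕ} [NeZero n] {T : BinTree n} {a : Unit} {l r : BinaryTree Unit}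
    (hT : T.1 = .node a l r) : rrmi (lambdaInv T) = rightArm l + 1 := by
  classical
  have h := isSplit_treeWord 0 a l r
  rw [rrmi_eq_countP, oneLine_lambdaInv, hT]
  set w := treeWord 0 (.node a l r)
  rw [← countP_rlMin_treeWord (0 + 1 + r.numNodes), h.eq, List.countP_append, List.countP_cons,
    ← h.eq]
  rw [(List.countP_eq_zero (l := treeWord (0 + 1) r)).2 fun x hx => ?_,
    List.countP_congr (l := treeWord (0 + 1 + r.numNodes) l)
      (q := fun x => decide (RlMin (treeWord (0 + 1 + r.numNodes) l) x)) fun x hx => ?_]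
  · simp [Bef.irrefl h.nodup]
  · have h1 : Bef w x 0 := h.bef_to_root_iff.2 hx
    simp only [h1, or_true, true_and, decide_eq_true_eq, RlMin, hx]
    refine forall_congr' fun y => ?_
    constructor
    · exact fun h2 h3 => h2 (h.bef_iff.2 (.inl h3)) (h.bef_to_root_iff.2 h3.mem_right)
    · intro h2 h3 h4
      exact h2 ((h.bef_to_left_iff (h.bef_to_root_iff.1 h4)).1 h3)
  · have h1 : x ≠ 0 := (h.root_lt_right x hx).ne'
    have h2 : ¬ Bef w x 0 := fun h2 =>
      absurd (h.right_lt_left x (h.bef_to_root_iff.1 h2) x hx) (lt_irrefl _)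
    simp [h1, h2]

/-! ### Restricted coinversions of the words of trees -/

/-- `q` and `r` are consecutive right-to-left minima of `w`. -/
def ConsMin (w : List ℕ) (q r : ℕ) : Prop :=
  RlMin w q ∧ RlMin w r ∧ q < r ∧ ∀ l, RlMin w l → ¬ (q < l ∧ l < r)

/-- `x` is weakly smaller and weakly to the left of the letter `z`, which is larger than all the
letters after it. -/
def CoinvMax (w : List ℕ) (x z : ℕ) : Prop :=
  x ≤ z ∧ (∀ y, Bef w z y → y < z) ∧ (x = z ∨ Bef w x z)

/-- The pair of the letters `x` and `z` is a restricted coinversion of the word `w`, which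
avoids `213`. -/
def RCoinv (w : List ℕ) (x z : ℕ) : Prop :=
  CoinvMax w x z ∧ ∃ r, RlMin w r ∧ Bef w z r ∧ ∀ q, ConsMin w q r → Bef w q x

theorem isConsecutiveRmi_iff {n : ℕ} {π : Equiv.Perm (Fin n)} {j i : Fin n} :
    IsConsecutiveRmi π j i ↔ ConsMin (oneLine π) (π j) (π i) := by
  rw [IsConsecutiveRmi, ConsMin, isRmi_iff, isRmi_iff, Fin.lt_def]
  refine and_congr_right fun _ => and_congr_right fun _ => and_congr_right fun _ => ?_
  constructor
  · intro h l hl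
    obtain ⟨k, rfl⟩ := mem_oneLine.1 hl.1
    exact h k (isRmi_iff.2 hl)
  · exact fun h l hl => h _ (isRmi_iff.1 hl)

/-- A larger letter after a descent would complete a 213, so a descent top exceeds everything to its
right. This replaces adjacency of positions by a condition on the order of letters. -/
theorem isDescentTop_iff {n : ℕ} {π : Equiv.Perm (Fin n)} (hπ : Avoids213 (oneLine π))
    {i : Fin n} : IsDescentTop π i ↔
      (∃ y, Bef (oneLine π) (π i) y) ∧ ∀ y, Bef (oneLine π) (π i) y → y < π i := by
  constructor
  · rintro ⟨j, hj, hji⟩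
    have hij : i < j := Fin.lt_def.2 (by omega)
    refine ⟨⟨_, bef_oneLine.2 hij⟩, fun y hy => ?_⟩
    obtain ⟨k, rfl⟩ := mem_oneLine.1 hy.mem_right
    rw [bef_oneLine] at hy
    rcases eq_or_ne k j with rfl | hkj
    · exact hji
    · have hjk : j < k := by
        rw [Fin.lt_def] at hy ⊢
        rw [Ne, Fin.ext_iff] at hkj
        omega
      have hne : (π k : ℕ) ≠ π i := fun h => hy.ne' (π.injective (Fin.ext h))
      by_contra hlt
      exact hπ _ _ _ (bef_oneLine.2 hij) (bef_oneLine.2 hjk) hji (by omega)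
  · rintro ⟨⟨y, hy⟩, h⟩
    obtain ⟨k, rfl⟩ := mem_oneLine.1 hy.mem_right
    rw [bef_oneLine, Fin.lt_def] at hy
    let j : Fin n := ⟨i + 1, by omega⟩
    exact ⟨j, rfl, h _ (bef_oneLine.2 (Fin.lt_def.2 (Nat.lt_succ_self i)))⟩

theorem isRestrictedCoinversion_iff {n : ℕ} {π : Equiv.Perm (Fin n)}
    (hπ : Avoids213 (oneLine π)) {i j : Fin n} :
    IsRestrictedCoinversion π i j ↔ RCoinv (oneLine π) (π i) (π j) := by
  rw [IsRestrictedCoinversion, RCoinv, CoinvMax, isDescentTop_iff hπ]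
  constructor
  · rintro ⟨h1, ⟨-, h3⟩, r, hr, h4, h5, h6⟩
    refine ⟨⟨h1, h3, ?_⟩, π r, isRmi_iff.1 hr, bef_oneLine.2 h6, fun q hq => ?_⟩
    · rcases h5.eq_or_lt with rfl | h5
      · exact .inl rfl
      · exact .inr (bef_oneLine.2 h5)
    · obtain ⟨q, rfl⟩ := mem_oneLine.1 hq.1.1
      exact bef_oneLine.2 (h4 q (isConsecutiveRmi_iff.2 hq))
  · rintro ⟨⟨h1, h3, h5⟩, r, hr, h6, h4⟩
    obtain ⟨r, rfl⟩ := mem_oneLine.1 hr.1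
    refine ⟨h1, ⟨⟨_, h6⟩, h3⟩, r, isRmi_iff.2 hr, fun q hq => bef_oneLine.1
      (h4 _ (isConsecutiveRmi_iff.1 hq)), ?_, bef_oneLine.1 h6⟩
    rcases h5 with h5 | h5
    · exact (π.injective (Fin.ext h5)).le
    · exact (bef_oneLine.1 h5).le

open Classical in
theorem rcinv_eq_sum {n : ℕ} {π : Equiv.Perm (Fin n)} (hπ : Avoids213 (oneLine π)) :
    rcinv π = ((oneLine π).map fun z =>
      (oneLine π).countP fun x => decide (RCoinv (oneLine π) x z)).sum := by
  rw [← sum_eq_sum_map_oneLine, rcinv, Finset.card_filter, ← Finset.univ_product_univ,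
    Finset.sum_product_right]
  refine Finset.sum_congr rfl fun j _ => ?_
  rw [← Finset.card_filter]
  exact card_filter_eq_countP_oneLine π _ _ fun i => isRestrictedCoinversion_iff hπ

namespace IsSplit

variable {w L R : List ℕ} {s : ℕ}

theorem coinvMax_left_iff (h : IsSplit w L s R) {x z : ℕ} (hz : z ∈ L) :
    CoinvMax w x z ↔ CoinvMax L x z := by
  rw [CoinvMax, CoinvMax, h.bef_to_left_iff hz]
  refine and_congr_right fun _ => and_congr_left fun _ => forall_congr' fun y => ?_
  rw [h.bef_left_iff hz]
  constructor
  · exact fun h1 h2 => h1 (.inl h2)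
  · rintro h1 (h2 | rfl | h2)
    exacts [h1 h2, h.root_lt_left z hz, h.right_lt_left z hz y h2]

theorem coinvMax_right_iff (h : IsSplit w L s R) {x z : ℕ} (hx : x ∈ R) (hz : z ∈ R) :
    CoinvMax w x z ↔ CoinvMax R x z := by
  simp only [CoinvMax, h.bef_right_iff hx, h.bef_right_iff hz]

theorem coinvMax_root_right_iff (h : IsSplit w L s R) {z : ℕ} (hz : z ∈ R) :
    CoinvMax w s z ↔ CoinvMax R z z := by
  simp only [CoinvMax, h.bef_root_iff, h.bef_right_iff hz, hz, or_true, true_or,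
    (h.root_lt_right z hz).le, le_refl]

theorem not_coinvMax_left (h : IsSplit w L s R) {x z : ℕ} (hx : x ∈ L) (hz : z = s ∨ z ∈ R) :
    ¬ CoinvMax w x z := fun h' => by
  rcases hz with rfl | hz
  · exact absurd h'.1 (by have := h.root_lt_left x hx; omega)
  · exact absurd h'.1 (by have := h.right_lt_left x hx z hz; omega)

theorem not_coinvMax_right_root (h : IsSplit w L s R) {x : ℕ} (hx : x ∈ R) :
    ¬ CoinvMax w x s := fun h' =>
  absurd h'.1 (by have := h.root_lt_right x hx; omega)

theorem coinvMax_root_root_iff (h : IsSplit w L s R) : CoinvMax w s s ↔ R = [] := by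
  simp only [CoinvMax, le_refl, true_and, true_or, and_true, h.bef_root_iff]
  constructor
  · intro h1
    exact List.eq_nil_iff_forall_not_mem.2 fun y hy =>
      absurd (h1 y hy) (by have := h.root_lt_right y hy; omega)
  · rintro rfl y hy
    simp at hy

theorem mem_left_of_coinvMax (h : IsSplit w L s R) {x z : ℕ} (hz : z ∈ L)
    (hx : CoinvMax w x z) : x ∈ L := by
  rcases hx.2.2 with rfl | h1
  · exact hz
  · exact ((h.bef_to_left_iff hz).1 h1).mem_left

/-- The block to the left of the first right-to-left minimum is L: take r = s, which has no
predecessor among the minima. -/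
theorem rCoinv_left_iff (h : IsSplit w L s R) {x z : ℕ} (hz : z ∈ L) :
    RCoinv w x z ↔ CoinvMax L x z := by
  rw [RCoinv, h.coinvMax_left_iff hz, and_iff_left]
  refine ⟨s, h.rlMin_root, h.bef_to_root_iff.2 hz, fun q hq => ?_⟩
  have h1 := h.le_of_mem hq.1.1
  have h2 := hq.2.2.1
  omega

theorem not_rCoinv_root (h : IsSplit w L s R) {z : ℕ} : ¬ RCoinv w s z := by
  rintro ⟨⟨-, -, hsz⟩, r, hr, hzr, hq⟩
  have hsr : Bef w s r := by
    rcases hsz with rfl | hsz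
    exacts [hzr, hsz.trans h.nodup hzr]
  have hlt := h.root_lt_right r (h.bef_root_iff.1 hsr)
  classical
  -- q is the predecessor of r among the minima. It would have to precede `s`, but L contains no
  -- minimum.
  obtain ⟨q, hq1, hq2⟩ := ((Finset.range r).filter (RlMin w)).exists_max_image id
    ⟨s, Finset.mem_filter.2 ⟨Finset.mem_range.2 hlt, h.rlMin_root⟩⟩
  rw [Finset.mem_filter, Finset.mem_range] at hq1
  have hqs := hq q ⟨hq1.2, hr, hq1.1, fun l hl hl' => absurd
    (hq2 l (Finset.mem_filter.2 ⟨Finset.mem_range.2 hl'.2, hl⟩)) (by simp; omega)⟩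
  exact h.not_rlMin_left (h.bef_to_root_iff.1 hqs) hq1.2

theorem consMin_right_iff (h : IsSplit w L s R) {q r : ℕ} (hq : q ∈ R) (hr : r ∈ R) :
    ConsMin w q r ↔ ConsMin R q r := by
  rw [ConsMin, ConsMin, h.rlMin_right_iff hq, h.rlMin_right_iff hr]
  refine and_congr_right fun _ => and_congr_right fun _ => and_congr_right fun _ => ?_
  constructor
  · exact fun h1 l hl => h1 l ((h.rlMin_right_iff hl.1).2 hl)
  · intro h1 l hl hl'
    rcases h.mem_iff.1 hl.1 with h2 | rfl | h2
    · exact h.not_rlMin_left h2 hl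
    · exact absurd (h.root_lt_right q hq) (by omega)
    · exact h1 l ((h.rlMin_right_iff h2).1 hl) hl'

theorem rCoinv_right_iff (h : IsSplit w L s R) {x z : ℕ} (hx : x ∈ R) (hz : z ∈ R) :
    RCoinv w x z ↔ RCoinv R x z := by
  rw [RCoinv, RCoinv, h.coinvMax_right_iff hx hz]
  refine and_congr_right fun _ => exists_congr fun r => ?_
  rw [h.bef_right_iff hz]
  constructor
  · rintro ⟨hr, hzr, h1⟩
    refine ⟨(h.rlMin_right_iff hzr.mem_right).1 hr, hzr, fun q hq => ?_⟩
    exact (h.bef_right_iff hq.1.1).1 (h1 q ((h.consMin_right_iff hq.1.1 hzr.mem_right).2 hq))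
  · rintro ⟨hr, hzr, h1⟩
    refine ⟨(h.rlMin_right_iff hzr.mem_right).2 hr, hzr, fun q hq => ?_⟩
    rcases h.mem_iff.1 hq.1.1 with h2 | rfl | h2
    · exact absurd hq.1 (h.not_rlMin_left h2)
    -- The first minimum of `R` acquires the predecessor `s` in `w`, which is harmless because `s`
    -- precedes all of `R`.
    · exact h.bef_root_iff.2 hx
    · exact (h.bef_right_iff h2).2 (h1 q ((h.consMin_right_iff h2 hzr.mem_right).1 hq))

end IsSplit

/-- The sum over the nodes without a left child of `d` plus the number of left edges on the path
from the root. -/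
def leafSum : ℕ → BinaryTree Unit → ℕ
  | _, .nil => 0
  | d, .node _ l r => (if l = .nil then d else 0) + leafSum (d + 1) l + leafSum d r

/-- The sum of `leafSum` over the mirrored left subtrees of the nodes on the right arm. -/
def armLeafSum : BinaryTree Unit → ℕ
  | .nil => 0
  | .node _ l r => leafSum 1 (mirror l) + armLeafSum r

theorem mirror_mirror (T : BinaryTree Unit) : mirror (mirror T) = T := by
  induction T with
  | nil => rfl
  | node a l r hl hr => rw [mirror, mirror, hl, hr]

theorem mirror_eq_nil_iff {T : BinaryTree Unit} : mirror T = .nil ↔ T = .nil := by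
  cases T <;> simp [mirror]

theorem armLeafSum_restrictedMirror (T : BinaryTree Unit) :
    armLeafSum (restrictedMirror T) = leafSum 0 T := by
  induction T with
  | nil => rfl
  | node a l r hl hr => simp [restrictedMirror, armLeafSum, leafSum, mirror_mirror, hr]

theorem treeWord_eq_nil_iff {s : ℕ} {T : BinaryTree Unit} : treeWord s T = [] ↔ T = .nil := by
  cases T <;> simp [treeWord_node]

-- A letter z exceeds everything after it iff its node has no right child. The letters weakly to its
-- left that are at most z are z and the ancestors having z in their right subtree, so their number
-- is one plus the number of right edges above z. Mirroring turns this into `leafSum`; `d` accounts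
-- for such ancestors outside `T`.
open Classical in
theorem sum_coinvMax_treeWord (s d : ℕ) (T : BinaryTree Unit) :
    ((treeWord s T).map fun z => (if CoinvMax (treeWord s T) z z then d else 0) +
      (treeWord s T).countP fun x => decide (CoinvMax (treeWord s T) x z)).sum =
      leafSum (d + 1) (mirror T) := by
  induction T generalizing s d with
  | nil => rfl
  | node a l r ihl ihr =>
    have h := isSplit_treeWord s a l r
    have ihl := ihl (s + 1 + r.numNodes) d
    have ihr := ihr (s + 1) (d + 1)
    set w := treeWord s (.node a l r)
    set L := treeWord (s + 1 + r.numNodes) l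
    set R := treeWord (s + 1) r
    have hRnil : R = [] ↔ mirror r = .nil := treeWord_eq_nil_iff.trans mirror_eq_nil_iff.symm
    have hcount : ∀ z, w.countP (fun x => decide (CoinvMax w x z)) =
        L.countP (fun x => decide (CoinvMax w x z)) + ((if CoinvMax w s z then 1 else 0) +
        R.countP (fun x => decide (CoinvMax w x z))) := fun z => by
      conv_lhs => rw [h.eq, List.countP_append, List.countP_cons, ← h.eq]
      simp [add_comm]
    rw [mirror, leafSum, ← ihl, ← ihr]
    conv_lhs => rw [h.eq, List.map_append, List.map_cons, List.sum_append, List.sum_cons, ← h.eq]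
    have e1 : ∀ z ∈ L, ((if CoinvMax w z z then d else 0) +
        w.countP fun x => decide (CoinvMax w x z)) = (if CoinvMax L z z then d else 0) +
        L.countP fun x => decide (CoinvMax L x z) := fun z hz => by
      have h1 : R.countP (fun x => decide (CoinvMax w x z)) = 0 :=
        List.countP_eq_zero.2 fun x hx => by
          simpa using fun h1 => (h.right_lt_left x (h.mem_left_of_coinvMax hz h1) x hx).false
      have h2 : ¬ CoinvMax w s z := fun h1 =>
        (h.root_lt_left s (h.mem_left_of_coinvMax hz h1)).false
      rw [hcount, h1]
      simp only [h.coinvMax_left_iff hz] at h2 ⊢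
      simp [h2]
    -- The root is counted once for each admissible z in `R`; this is absorbed by passing from `d`
    -- to `d + 1`.
    have e2 : ∀ z ∈ R, ((if CoinvMax w z z then d else 0) +
        w.countP fun x => decide (CoinvMax w x z)) = (if CoinvMax R z z then d + 1 else 0) +
        R.countP fun x => decide (CoinvMax R x z) := fun z hz => by
      rw [hcount, List.countP_eq_zero.2 fun x hx => by
          simpa using h.not_coinvMax_left hx (.inr hz), h.coinvMax_root_right_iff hz,
        h.coinvMax_right_iff hz hz,
        List.countP_congr (l := R) (q := fun x => decide (CoinvMax R x z)) fun x hx => by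
          simpa using h.coinvMax_right_iff hx hz]
      split_ifs <;> omega
    have e3 : ((if CoinvMax w s s then d else 0) +
        w.countP fun x => decide (CoinvMax w x s)) = if mirror r = .nil then d + 1 else 0 := by
      rw [hcount, List.countP_eq_zero.2 fun x hx => by
          simpa using h.not_coinvMax_left hx (.inl rfl),
        (List.countP_eq_zero (l := R)).2 fun x hx => by simpa using h.not_coinvMax_right_root hx]
      simp only [h.coinvMax_root_root_iff, hRnil]
      split_ifs <;> omega
    rw [List.map_congr_left e1, List.map_congr_left e2, e3]
    omega

-- Restricted coinversions stay within the left subtree of a single arm node, where they are the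
-- pairs of `CoinvMax`.
open Classical in
theorem sum_rCoinv_treeWord (s : ℕ) (T : BinaryTree Unit) :
    ((treeWord s T).map fun z =>
      (treeWord s T).countP fun x => decide (RCoinv (treeWord s T) x z)).sum = armLeafSum T := by
  induction T generalizing s with
  | nil => rfl
  | node a l r ihl ihr =>
    have h := isSplit_treeWord s a l r
    have ihl := sum_coinvMax_treeWord (s + 1 + r.numNodes) 0 l
    have ihr := ihr (s + 1)
    set w := treeWord s (.node a l r)
    set L := treeWord (s + 1 + r.numNodes) l
    set R := treeWord (s + 1) r
    have hcount : ∀ z, w.countP (fun x => decide (RCoinv w x z)) =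
        L.countP (fun x => decide (RCoinv w x z)) +
        R.countP (fun x => decide (RCoinv w x z)) := fun z => by
      conv_lhs => rw [h.eq, List.countP_append, List.countP_cons, ← h.eq]
      simp [h.not_rCoinv_root]
    rw [armLeafSum, ← ihl, ← ihr]
    conv_lhs => rw [h.eq, List.map_append, List.map_cons, List.sum_append, List.sum_cons, ← h.eq]
    have e1 : ∀ z ∈ L, w.countP (fun x => decide (RCoinv w x z)) =
        (if CoinvMax L z z then 0 else 0) +
        L.countP fun x => decide (CoinvMax L x z) := fun z hz => by
      rw [hcount, (List.countP_eq_zero (l := R)).2 fun x hx => by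
        simpa using fun h1 : RCoinv w x z =>
          (h.right_lt_left x (h.mem_left_of_coinvMax hz h1.1) x hx).false]
      simp [h.rCoinv_left_iff hz]
    have e2 : ∀ z ∈ R, w.countP (fun x => decide (RCoinv w x z)) =
        R.countP fun x => decide (RCoinv R x z) := fun z hz => by
      rw [hcount, List.countP_eq_zero.2 fun x hx => by
          simpa using fun h1 : RCoinv w x z => h.not_coinvMax_left hx (.inr hz) h1.1,
        List.countP_congr (l := R) (q := fun x => decide (RCoinv R x z)) fun x hx => by
          simpa using h.rCoinv_right_iff hx hz, zero_add]
    have e3 : w.countP (fun x => decide (RCoinv w x s)) = 0 := by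
      refine List.countP_eq_zero.2 fun x hx => ?_
      rw [decide_eq_true_eq]
      rcases h.mem_iff.1 hx with h1 | rfl | h1
      · exact fun h2 => h.not_coinvMax_left h1 (.inl rfl) h2.1
      · exact h.not_rCoinv_root
      · exact fun h2 => h.not_coinvMax_right_root h1 h2.1
    rw [List.map_congr_left e1, List.map_congr_left e2, e3, zero_add]

theorem rcinv_lambdaInv {n : ℕ} (T : BinTree n) : rcinv (lambdaInv T) = armLeafSum T.1 := by
  rw [rcinv_eq_sum (by rw [oneLine_lambdaInv]; exact avoids213_treeWord _ _), oneLine_lambdaInv,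
    sum_rCoinv_treeWord]

/-! ### Columns of Dyck paths and of trees -/

/-- For every column of the path `w` that starts `c` units below the diagonal: its distance to
the diagonal, and whether its east step is followed by a north step. -/
def columns : ℕ → List DyckStep → List (ℕ × Bool)
  | _, [] => []
  | c, .U :: w => (c, decide (w.head? = some .D)) :: columns (c + 1) w
  | c, .D :: w => columns (c - 1) w

/-- The nodes of a tree in pre-order, with the number `c` of left edges on the path from the root
increased by the given number, and whether the node has no left child. -/
def treeColumns : ℕ → BinaryTree Unit → List (ℕ × Bool)
  | _, .nil => []
  | c, .node _ l r => (c, decide (l = .nil)) :: (treeColumns (c + 1) l ++ treeColumns c r)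

theorem forestBin_eq_nil_iff {ts : List PlaneTree} : forestBin ts = .nil ↔ ts = [] := by
  rcases ts with - | ⟨⟨cs⟩, ts⟩ <;> simp [forestBin]

theorem toList_forestDyck_nil : (forestDyck []).toList = [] := by
  rw [forestDyck]
  rfl

theorem toList_forestDyck_cons (cs ts : List PlaneTree) :
    (forestDyck (.node cs :: ts)).toList =
      .U :: ((forestDyck cs).toList ++ .D :: (forestDyck ts).toList) := by
  rw [forestDyck]
  change ([DyckStep.U] ++ (forestDyck cs).toList ++ [.D]) ++ (forestDyck ts).toList = _
  simp

/-- An east step is the first visit of a node. Its distance to the diagonal is the number of edges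
still open, which become the left edges of the binary tree; a north step follows iff the node has no
child. The tail `v` is needed because the children's path is followed by a closing north step. -/
theorem columns_forestDyck_append (c : ℕ) : ∀ (ts : List PlaneTree) (v : List DyckStep),
    columns c ((forestDyck ts).toList ++ v) = treeColumns c (forestBin ts) ++ columns c v
  | [], v => by simp [toList_forestDyck_nil, forestBin, treeColumns]
  | .node cs :: ts, v => by
    have e : (forestDyck (.node cs :: ts)).toList ++ v =
        .U :: ((forestDyck cs).toList ++ .D :: ((forestDyck ts).toList ++ v)) := by
      simp [toList_forestDyck_cons]
    have hhead : ((forestDyck cs).toList ++ .D :: ((forestDyck ts).toList ++ v)).head? =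
        some DyckStep.D ↔ forestBin cs = .nil := by
      rw [forestBin_eq_nil_iff]
      rcases cs with - | ⟨⟨cs⟩, cs'⟩ <;>
        simp [toList_forestDyck_nil, toList_forestDyck_cons]
    rw [e, columns, forestBin, treeColumns, columns_forestDyck_append (c + 1) cs, columns,
      Nat.add_sub_cancel, columns_forestDyck_append c ts]
    simp only [hhead, List.cons_append, List.append_assoc]

theorem columns_replicate_D_append (c k : ℕ) (v : List DyckStep) :
    columns c (List.replicate k .D ++ v) = columns (c - k) v := by
  induction k generalizing c with
  | zero => simp
  | succ k ih => rw [List.replicate_succ, List.cons_append, columns, ih, Nat.sub_sub, add_comm]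

theorem columns_rhoSteps {n : ℕ} (π : Equiv.Perm (Fin n)) :
    columns 0 (rhoSteps π n) = (List.range n).map fun i =>
      (i - colHeight π i, decide (colHeight π i < colHeight π (i + 1))) := by
  -- The induction runs over the remaining columns, so it is stated for the part of the path from
  -- column i on.
  have key : ∀ m i, i + m ≤ n → columns (i - colHeight π i) ((List.range' i m).flatMap fun i =>
      .U :: List.replicate (colHeight π (i + 1) - colHeight π i) .D) =
      (List.range' i m).map fun i =>
        (i - colHeight π i, decide (colHeight π i < colHeight π (i + 1))) := by
    intro m
    induction m with
    | zero => intro i _; rfl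
    | succ m ih =>
      intro i hi
      have h1 := colHeight_le π i (by omega)
      have h2 := colHeight_le π (i + 1) (by omega)
      have h3 := colHeight_mono π i
      rw [List.range'_succ, List.flatMap_cons, List.cons_append, columns,
        columns_replicate_D_append, List.map_cons, ← ih (i + 1) (by omega)]
      congr 2
      · rw [decide_eq_decide]
        rcases Nat.eq_zero_or_pos (colHeight π (i + 1) - colHeight π i) with h0 | h0
        · rw [h0]
          cases m with
          | zero => simp; omega
          | succ m => simp [List.range'_succ]; omega
        · obtain ⟨k, hk⟩ := Nat.exists_eq_add_of_lt h0
          rw [hk]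
          simp [List.replicate_succ]
          omega
      · have h4 : i - colHeight π i + 1 - (colHeight π (i + 1) - colHeight π i) =
            i + 1 - colHeight π (i + 1) := by omega
        rw [h4]
  have h0 := Nat.le_zero.1 (colHeight_le π 0 (Nat.zero_le n))
  have := key n 0 (by omega)
  rwa [h0, ← List.range_eq_range'] at this

/-- The binary tree of a permutation. -/
def permTree {n : ℕ} (π : Equiv.Perm (Fin n)) : BinTree n := phi ((tau n).symm (rho π))

theorem upsilon_eq {n : ℕ} (π : Equiv.Perm (Fin n)) :
    upsilon π = lambdaInv (gamma (permTree π)) := rfl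

/-- The bridge between permutation and tree: tree statistics become statements about column heights.
-/
theorem treeColumns_permTree {n : ℕ} (π : Equiv.Perm (Fin n)) :
    treeColumns 0 (permTree π).1 = (List.range n).map fun i =>
      (i - colHeight π i, decide (colHeight π i < colHeight π (i + 1))) := by
  have h1 := columns_forestDyck_append 0 (dyckForest (rho π).1) []
  rw [forestDyck_dyckForest, List.append_nil, columns, List.append_nil] at h1
  rw [← columns_rhoSteps]
  exact h1.symm

/-! ### Columns of trees and statistics of trees -/

theorem le_of_mem_treeColumns {c : ℕ} {T : BinaryTree Unit} {x : ℕ × Bool}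
    (hx : x ∈ treeColumns c T) : c ≤ x.1 := by
  induction T generalizing c with
  | nil => simp [treeColumns] at hx
  | node a l r hl hr =>
    simp only [treeColumns, List.mem_cons, List.mem_append] at hx
    rcases hx with rfl | hx | hx
    exacts [le_rfl, (Nat.le_succ c).trans (hl hx), hr hx]

theorem length_treeColumns (c : ℕ) (T : BinaryTree Unit) :
    (treeColumns c T).length = T.numNodes := by
  induction T generalizing c with
  | nil => rfl
  | node a l r hl hr => simp [treeColumns, BinaryTree.numNodes, hl, hr]

theorem exists_mem_treeColumns_iff {c k : ℕ} {T : BinaryTree Unit} :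
    (∃ x ∈ treeColumns c T, c + k ≤ x.1) ↔ k < leftHeight T := by
  induction T generalizing c k with
  | nil => simp [treeColumns, leftHeight]
  | node a l r hl hr =>
    rw [leftHeight, lt_max_iff, ← hr (c := c)]
    simp only [treeColumns, List.mem_cons, List.mem_append, or_and_right, exists_or,
      exists_eq_left]
    rw [← or_assoc]
    refine or_congr_left ?_
    cases k with
    | zero => simp
    | succ k =>
      rw [Nat.add_lt_add_iff_right, ← hl (c := c + 1), add_assoc c 1 k, add_comm 1 k]
      simp

theorem countP_treeColumns_eq (c : ℕ) (T : BinaryTree Unit) :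
    (treeColumns c T).countP (fun x => decide (x.1 = c)) = rightArm T := by
  induction T with
  | nil => rfl
  | node a l r hl hr =>
    rw [treeColumns, List.countP_cons, List.countP_append, hr, rightArm,
      List.countP_eq_zero.2 fun x hx => by
        have := le_of_mem_treeColumns hx
        simp
        omega]
    simp

theorem sum_treeColumns (c : ℕ) (T : BinaryTree Unit) :
    ((treeColumns c T).map fun x => if x.2 then x.1 else 0).sum = leafSum c T := by
  induction T generalizing c with
  | nil => rfl
  | node a l r hl hr =>
    simp [treeColumns, leafSum, hl, hr, add_assoc]

/-- Pre-order first descends the left arm, and the end of this arm is the first node without a left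
child. The existence clause keeps the search inside the left subtree during the induction. -/
theorem findIdx_treeColumns {c : ℕ} {T : BinaryTree Unit} (hT : T ≠ .nil) :
    (treeColumns c T).findIdx (·.2) + 1 = leftArm T ∧ ∃ x ∈ treeColumns c T, x.2 := by
  induction T generalizing c with
  | nil => exact absurd rfl hT
  | node a l r hl hr =>
    rw [treeColumns, leftArm, List.findIdx_cons]
    by_cases h : l = .nil
    · subst h
      simp [leftArm]
    · obtain ⟨h1, x, hx, hx2⟩ := hl (c := c + 1) h
      refine ⟨?_, x, by simp [hx], hx2⟩
      simp only [h, decide_false, cond_false]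
      rw [List.findIdx_append, if_pos (List.findIdx_lt_length.2 ⟨x, hx, hx2⟩), h1]

theorem head?_treeColumns {c : ℕ} {T : BinaryTree Unit} {x : ℕ × Bool}
    (h : (treeColumns c T).head? = some x) : x.1 = c := by
  cases T with
  | nil => simp [treeColumns] at h
  | node a l r =>
    simp only [treeColumns, List.head?_cons, Option.some.injEq] at h
    rw [← h]

/-- This makes the heights read off from an arbitrary tree weakly increasing, as surjectivity
requires. -/
theorem isChain_treeColumns (c : ℕ) (T : BinaryTree Unit) :
    (treeColumns c T).IsChain fun x y => y.1 ≤ x.1 + 1 := by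
  induction T generalizing c with
  | nil => exact List.isChain_nil
  | node a l r hl hr =>
    rw [treeColumns, List.isChain_cons, List.isChain_append]
    refine ⟨fun y hy => ?_, hl _, hr _, fun x hx y hy => ?_⟩
    · rw [List.head?_append, Option.mem_def, Option.or_eq_some_iff] at hy
      rcases hy with hy | ⟨-, hy⟩
      · exact (head?_treeColumns hy).le
      · exact (head?_treeColumns hy).le.trans (Nat.le_succ c)
    · have h1 := le_of_mem_treeColumns (List.mem_of_getLast? hx)
      have h2 := head?_treeColumns hy
      omega

/-- After the root, the entries larger than c form an initial run that belongs to the left subtree;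
the right subtree, if any, starts with c. -/
theorem treeColumns_injective {c : ℕ} {T T' : BinaryTree Unit}
    (h : (treeColumns c T).map Prod.fst = (treeColumns c T').map Prod.fst) : T = T' := by
  induction T generalizing c T' with
  | nil =>
    cases T' with
    | nil => rfl
    | node a l r => simp [treeColumns] at h
  | node a l r hl hr =>
    cases T' with
    | nil => simp [treeColumns] at h
    | node a' l' r' =>
      have key : ∀ l r, (((treeColumns (c + 1) l ++ treeColumns c r).map Prod.fst).takeWhile
          fun x => decide (c < x)) = (treeColumns (c + 1) l).map Prod.fst := fun l r => by
        rw [List.map_append, List.takeWhile_append_of_pos fun x hx => by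
          obtain ⟨y, hy, rfl⟩ := List.mem_map.1 hx
          simpa using le_of_mem_treeColumns hy]
        cases r <;> simp [treeColumns]
      simp only [treeColumns, List.map_cons, List.cons.injEq, true_and] at h
      have h1 := congrArg (List.takeWhile fun x => decide (c < x)) h
      rw [key, key] at h1
      obtain rfl := hl h1
      rw [List.map_append, List.map_append] at h
      obtain rfl := hr (List.append_cancel_left h)
      rfl

/-! ### Column heights and right-to-left minima -/

section

variable {n : ℕ} {π : Equiv.Perm (Fin n)}

theorem le_colHeight_iff {i m : ℕ} (hm : m ≤ n) :
    m ≤ colHeight π i ↔ ∀ j : Fin n, i ≤ (j : ℕ) → m ≤ (π j : ℕ) :=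
  ⟨fun h j hj => h.trans (colHeight_spec π i j hj), fun h => Nat.le_findGreatest hm h⟩

theorem exists_apply_eq_colHeight {i : ℕ} (hi : i < n) :
    ∃ p : Fin n, i ≤ (p : ℕ) ∧ (π p : ℕ) = colHeight π i := by
  by_contra! h
  have h1 := colHeight_le π i hi.le
  have := (le_colHeight_iff (π := π) (i := i) (m := colHeight π i + 1) (by omega)).2 fun j hj =>
    lt_of_le_of_ne (colHeight_spec π i j hj) (h j hj).symm
  omega

theorem IsRmi.colHeight_eq {i : Fin n} (h : IsRmi π i) : colHeight π i = π i := by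
  refine le_antisymm (colHeight_spec π i i le_rfl) ((le_colHeight_iff (π i).2.le).2 fun j hj => ?_)
  rcases (Fin.le_def.2 hj : i ≤ j).eq_or_lt with rfl | hj
  · exact le_rfl
  · exact (Fin.lt_def.1 (h j hj)).le

/-- The column height is the minimum of the remaining letters, and it rises exactly when the letter
just passed was that minimum. -/
theorem isRmi_iff_colHeight_lt {i : Fin n} :
    IsRmi π i ↔ colHeight π i < colHeight π (i + 1) := by
  constructor
  · intro h
    rw [h.colHeight_eq, ← Nat.succ_le_iff, le_colHeight_iff (π i).2]
    exact fun j hj => Fin.lt_def.1 (h j (Fin.lt_def.2 hj))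
  · intro h j hj
    obtain ⟨p, hp, hpi⟩ := exists_apply_eq_colHeight (π := π) i.2
    have hpi' : p = i := by
      by_contra hne
      have := colHeight_spec π (i + 1) p (by rw [Fin.ext_iff] at hne; omega)
      omega
    subst hpi'
    rw [Fin.lt_def, hpi]
    exact h.trans_le (colHeight_spec π _ j (Fin.lt_def.1 hj))

theorem isRmi_of_apply_eq_colHeight {i : ℕ} {p : Fin n} (hp : i ≤ (p : ℕ))
    (h : (π p : ℕ) = colHeight π i) : IsRmi π p := fun j hj => by
  refine lt_of_le_of_ne (Fin.le_def.2 (h ▸ colHeight_spec π i j ?_)) (π.injective.ne hj.ne)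
  have := Fin.lt_def.1 hj
  omega

/-- Every letter has at least as many larger letters on its left as it is away from its place. -/
theorem le_card_larger_left_add (p : Fin n) :
    (p : ℕ) ≤ (Finset.univ.filter fun i => i < p ∧ π p < π i).card + π p := by
  have h1 : (Finset.Iio p).card ≤ ((Finset.univ.filter fun i => i < p ∧ π p < π i) ∪
      (Finset.Iio (π p)).map π.symm.toEmbedding).card := by
    refine Finset.card_le_card fun i hi => ?_
    rw [Finset.mem_Iio] at hi
    rw [Finset.mem_union, Finset.mem_filter, Finset.mem_map_equiv, Finset.mem_Iio]
    rcases lt_or_gt_of_ne (π.injective.ne hi.ne) with h | h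
    · exact .inr (by simpa using h)
    · exact .inl ⟨Finset.mem_univ i, hi, h⟩
  have h2 := h1.trans (Finset.card_union_le _ _)
  simpa using h2

/-- All smaller letters lie to the left of a right-to-left minimum, so the other positions before
`p` carry the larger ones. -/
theorem IsRmi.card_larger_left {p : Fin n} (hp : IsRmi π p) :
    (Finset.univ.filter fun i => i < p ∧ π p < π i).card = p - π p := by
  have h1 : ((Finset.univ.filter fun i => i < p ∧ π p < π i) ∪
      (Finset.Iio (π p)).map π.symm.toEmbedding).card = (Finset.Iio p).card := by
    congr 1
    ext i
    rw [Finset.mem_Iio, Finset.mem_union, Finset.mem_filter, Finset.mem_map_equiv, Finset.mem_Iio]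
    constructor
    · rintro (h | h)
      · exact h.2.1
      · rw [Equiv.symm_symm] at h
        by_contra hlt
        rcases (not_lt.1 hlt).eq_or_lt with rfl | h'
        · exact lt_irrefl _ h
        · exact (hp i h').asymm h
    · intro hi
      rcases lt_or_gt_of_ne (π.injective.ne hi.ne) with h | h
      · exact .inr (by simpa using h)
      · exact .inl ⟨Finset.mem_univ i, hi, h⟩
  rw [Finset.card_union_of_disjoint] at h1
  · simp at h1
    omega
  · rw [Finset.disjoint_left]
    intro i hi hi'
    rw [Finset.mem_filter] at hi
    rw [Finset.mem_map_equiv, Finset.mem_Iio, Equiv.symm_symm] at hi'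
    exact hi.2.2.asymm hi'

/-! ### The permutations that avoid `321` -/

/-- `w` avoids the pattern `321`. -/
def Avoids321 (w : List ℕ) : Prop :=
  ∀ x y z, Bef w x y → Bef w y z → z < y → y < x → False

theorem Avoids321.avoids3241 {w : List ℕ} (hw : w.Nodup) (h : Avoids321 w) : Avoids3241 w :=
  fun a b _ d hab hbc hcd h1 h2 _ => h a b d hab (hbc.trans hw hcd) h1 h2

theorem avoids321_oneLine_iff :
    Avoids321 (oneLine π) ↔ ∀ i j k, i < j → j < k → π k < π j → π j < π i → False := by
  constructor
  · exact fun h i j k hij hjk => h _ _ _ (bef_oneLine.2 hij) (bef_oneLine.2 hjk)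
  · intro h x y z hxy hyz
    obtain ⟨i, j, hij, rfl, rfl⟩ := bef_oneLine_iff.1 hxy
    obtain ⟨k, rfl⟩ := mem_oneLine.1 hyz.mem_right
    exact h i j k hij (bef_oneLine.1 hyz)

theorem mem_avoiders_321_iff : π ∈ avoiders n ![3, 2, 1] ↔ Avoids321 (oneLine π) := by
  rw [avoids321_oneLine_iff, avoiders, Set.mem_ofPred_eq, not_iff_comm]
  simp only [not_forall]
  constructor
  · rintro ⟨i, j, k, hij, hjk, h1, h2, -⟩
    refine ⟨![i, j, k], ?_, ?_⟩
    · rw [Fin.strictMono_iff_lt_succ]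
      intro a
      fin_cases a
      exacts [hij, hjk]
    · intro a b
      fin_cases a <;> fin_cases b <;> simp <;> omega
  · rintro ⟨f, hf, h⟩
    exact ⟨f 0, f 1, f 2, hf (by decide), hf (by decide), (h 2 1).2 (by simp),
      (h 1 0).2 (by simp), id⟩

theorem oneLine_refl : oneLine (Equiv.refl (Fin n)) = List.range n :=
  List.ext_getElem (by simp [oneLine]) fun i h1 h2 => by simp [oneLine]

/-- The smaller letter of an inversion is a right-to-left minimum, since a still smaller letter
after it would complete a 321. The inversions are grouped by that letter. -/
theorem inv_eq_sum (hπ : Avoids321 (oneLine π)) :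
    inv π = ((List.range n).map fun i =>
      if colHeight π i < colHeight π (i + 1) then i - colHeight π i else 0).sum := by
  classical
  rw [avoids321_oneLine_iff] at hπ
  rw [← oneLine_refl, ← sum_eq_sum_map_oneLine, inv, Finset.card_filter,
    ← Finset.univ_product_univ, Finset.sum_product_right]
  refine Finset.sum_congr rfl fun j _ => ?_
  rw [← Finset.card_filter, Equiv.refl_apply]
  split_ifs with h
  · rw [← isRmi_iff_colHeight_lt] at h
    rw [h.card_larger_left, h.colHeight_eq]
  · rw [← isRmi_iff_colHeight_lt] at h
    rw [Finset.card_eq_zero, Finset.filter_eq_empty_iff]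
    rintro i - ⟨h1, h2⟩
    simp only [IsRmi, not_forall, not_lt] at h
    obtain ⟨k, hjk, hk⟩ := h
    exact hπ i j k h1 hjk (lt_of_le_of_ne hk (π.injective.ne hjk.ne')) h2

theorem exists_isConsecutiveRmi {i : Fin n} (hi : IsRmi π i) (h0 : (π i : ℕ) ≠ 0) :
    ∃ j, IsConsecutiveRmi π j i := by
  classical
  have hn : 0 < n := i.pos
  obtain ⟨p, -, hp⟩ := exists_apply_eq_colHeight (π := π) hn
  have hp' := isRmi_of_apply_eq_colHeight (Nat.zero_le _) hp
  have hp0 := colHeight_le π 0 hn.le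
  obtain ⟨j, hj, hmax⟩ := (Finset.univ.filter fun j => IsRmi π j ∧ π j < π i).exists_max_image π
    ⟨p, Finset.mem_filter.2 ⟨Finset.mem_univ p, hp', Fin.lt_def.2 (by omega)⟩⟩
  simp only [Finset.mem_filter, Finset.mem_univ, true_and] at hj hmax
  exact ⟨j, hj.1, hi, hj.2, fun l hl h => (hmax l ⟨hl, h.2⟩).not_gt h.1⟩

/-- Primality means that the path meets the diagonal at height `π i`: the preceding minimum sits in
the column just before that point, and `π i` is the least letter from there on. -/
theorem isPrimeRmi_iff {i : Fin n} : IsPrimeRmi π i ↔ colHeight π (π i) = π i := by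
  constructor
  · rintro ⟨hi, h | ⟨j, hj, hji⟩⟩
    · have h0 : (π i : ℕ) = 0 := by
        by_contra h0
        exact h (exists_isConsecutiveRmi hi h0)
      rw [h0]
      exact Nat.le_zero.1 (colHeight_le π 0 (Nat.zero_le n))
    · obtain ⟨hj1, -, hlt, hcons⟩ := hj
      rw [Nat.add_sub_cancel] at hji
      refine le_antisymm (colHeight_le π _ (π i).2.le) ?_
      have hlt' : (j : ℕ) + 1 < n := hji ▸ (π i).2
      obtain ⟨p, hp, hpj⟩ := exists_apply_eq_colHeight (π := π) hlt'
      have h1 := hcons p (isRmi_of_apply_eq_colHeight hp hpj)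
      have h2 := hj1 p (Fin.lt_def.2 (by omega))
      rw [← hji] at hpj
      rw [← hpj]
      exact Fin.le_def.1 (not_lt.1 fun h => h1 ⟨h2, h⟩)
  · intro h
    obtain ⟨p, hp, hpi⟩ := exists_apply_eq_colHeight (π := π) (π i).2
    have hrmi := isRmi_of_apply_eq_colHeight hp hpi
    obtain rfl : p = i := π.injective (Fin.ext (hpi.trans h))
    refine ⟨hrmi, ?_⟩
    rw [or_iff_not_imp_left, not_not]
    rintro ⟨q, hq⟩
    have hq0 := Fin.lt_def.1 hq.2.2.1
    have hspec : ∀ l : Fin n, (π p : ℕ) ≤ l → (π p : ℕ) ≤ π l := fun l hl =>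
      h.symm.le.trans (colHeight_spec π _ l hl)
    -- The last column before the contact with the diagonal; the path rises after it, so it carries
    -- a right-to-left minimum.
    let j : Fin n := ⟨π p - 1, by omega⟩
    have hj1 : (j : ℕ) + 1 = π p := by simp only [j]; omega
    have hj : IsRmi π j := by
      rw [isRmi_iff_colHeight_lt, hj1, h]
      have := colHeight_le π j j.2.le
      omega
    have hje := hj.colHeight_eq
    have hjle := colHeight_le π j j.2.le
    refine ⟨j, ⟨hj, hrmi, Fin.lt_def.2 (by omega), fun l hl hl' => ?_⟩, by omega⟩
    have h1 : (l : ℕ) < π p := by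
      by_contra h1
      exact absurd (Fin.lt_def.1 hl'.2) (not_lt.2 (hspec l (not_lt.1 h1)))
    rcases (Fin.le_def.2 (by omega) : l ≤ j).eq_or_lt with rfl | h2
    · exact lt_irrefl _ hl'.1
    · exact (hl j h2).asymm hl'.1

theorem prmi_eq_countP (π : Equiv.Perm (Fin n)) :
    prmi π = (List.range n).countP fun i => decide (i - colHeight π i = 0) := by
  classical
  have h1 : prmi π = (Finset.univ.filter fun i : Fin n => (i : ℕ) - colHeight π i = 0).card := by
    rw [prmi]
    -- A prime minimum at position i corresponds to the column indexed by its letter, not to column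
    -- i.
    refine Finset.card_equiv π fun i => ?_
    have := colHeight_le π (π i) (π i).2.le
    simp only [Finset.mem_filter, Finset.mem_univ, true_and, isPrimeRmi_iff]
    omega
  have h2 := card_filter_eq_countP_oneLine (Equiv.refl (Fin n))
    (fun i => (i : ℕ) - colHeight π i = 0) (fun i => i - colHeight π i = 0) fun i => Iff.rfl
  rw [h1, h2, oneLine_refl]

/-- The heights are zero up to the position of the least letter and rise right after it. -/
theorem pone_eq_findIdx [NeZero n] (π : Equiv.Perm (Fin n)) :
    pone π = ((List.range n).map fun i => decide (colHeight π i < colHeight π (i + 1))).findIdx id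
      + 1 := by
  rw [pone, Nat.add_right_cancel_iff, eq_comm, List.findIdx_eq (by simp)]
  have h0 : ((π (π.symm 0) : Fin n) : ℕ) = 0 := by simp
  have hz : ∀ i ≤ ((π.symm 0 : Fin n) : ℕ), colHeight π i = 0 := fun i hi =>
    Nat.le_zero.1 (h0 ▸ colHeight_spec π i (π.symm 0) hi)
  simp only [List.getElem_map, List.getElem_range, id_eq, decide_eq_true_eq, decide_eq_false_iff_not]
  constructor
  · refine isRmi_iff_colHeight_lt.1 fun j hj => ?_
    rw [Fin.lt_def, h0, Nat.pos_iff_ne_zero]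
    exact fun h => hj.ne' (π.injective (Fin.ext (h.trans h0.symm)))
  · intro j hj
    rw [hz (j + 1) hj]
    omega

/-! ### Stack-sortable permutations that avoid `321` -/

theorem exists_finset_of_asc {w : List ℕ} {p : ℕ → Prop} {k a : ℕ} (h : Asc w p k a) :
    ∃ V : Finset ℕ, V.card = k + 1 ∧ ∀ x ∈ V, a ≤ x ∧ p x := by
  induction k generalizing a with
  | zero => exact ⟨{a}, by simp, by simpa using h.head⟩
  | succ k ih =>
    obtain ⟨h1, a', h2, -, h4⟩ := h
    obtain ⟨V, hV, hV'⟩ := ih h4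
    refine ⟨insert a V, ?_, ?_⟩
    · rw [Finset.card_insert_of_notMem fun ha => absurd (hV' a ha).1 (by omega), hV]
    · intro x hx
      rcases Finset.mem_insert.1 hx with rfl | hx
      · exact ⟨le_rfl, h1⟩
      · exact ⟨by have := (hV' x hx).1; omega, (hV' x hx).2⟩

theorem exists_asc_of_finset {p : ℕ → Prop} {k : ℕ} {S : Finset (Fin n)} (hS : k + 1 ≤ S.card)
    (hp : ∀ i ∈ S, p (π i)) (hmono : ∀ i ∈ S, ∀ j ∈ S, i < j → π i < π j) :
    ∃ i ∈ S, Asc (oneLine π) p k (π i) := by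
  induction k generalizing S with
  | zero =>
    obtain ⟨i, hi⟩ := Finset.card_pos.1 (by omega : 0 < S.card)
    exact ⟨i, hi, hp i hi⟩
  | succ k ih =>
    have hne := Finset.card_pos.1 (by omega : 0 < S.card)
    have hmem := S.min'_mem hne
    obtain ⟨i, hi, h⟩ := ih (S := S.erase (S.min' hne))
      (by rw [Finset.card_erase_of_mem hmem]; omega)
      (fun i hi => hp i (Finset.mem_of_mem_erase hi))
      fun i hi j hj => hmono i (Finset.mem_of_mem_erase hi) j (Finset.mem_of_mem_erase hj)
    have hlt := S.min'_lt_of_mem_erase_min' hne hi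
    exact ⟨_, hmem, hp _ hmem, _,
      Fin.lt_def.1 (hmono _ hmem i (Finset.mem_of_mem_erase hi) hlt), bef_oneLine.2 hlt, h⟩

/-- Larger letters to the left of a given letter are increasing in a 321-avoider, so only their
number matters. A letter attaining the height of column j stands at some p ≥ j and has at least p -
`colHeight π j` larger letters on its left. -/
theorem exists_ascBefore_oneLine_iff (hπ : Avoids321 (oneLine π)) {t : ℕ} :
    (∃ b a, AscBefore (oneLine π) b t a) ↔ ∃ j < n, t + 1 ≤ j - colHeight π j := by
  rw [avoids321_oneLine_iff] at hπ
  constructor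
  · rintro ⟨b, a, h⟩
    obtain ⟨j, rfl⟩ := mem_oneLine.1 h.head.2.mem_right
    obtain ⟨V, hV, hV'⟩ := exists_finset_of_asc h
    have hj := colHeight_spec π j j le_rfl
    have hcol := colHeight_le π j j.2.le
    have hlt := j.2
    refine ⟨j, j.2, ?_⟩
    -- Letters below the height of column j all stand before j and are disjoint from the letters in
    -- `V`; together they fit into j positions.
    have h1 : V ∪ Finset.range (colHeight π j) ⊆ (Finset.Iio j).image fun i => (π i : ℕ) := by
      intro x hx
      rw [Finset.mem_image]
      rcases Finset.mem_union.1 hx with hx | hx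
      · obtain ⟨i, rfl⟩ := mem_oneLine.1 (hV' x hx).2.2.mem_left
        exact ⟨i, Finset.mem_Iio.2 (bef_oneLine.1 (hV' _ hx).2.2), rfl⟩
      · rw [Finset.mem_range] at hx
        obtain ⟨i, rfl⟩ := (mem_oneLine (π := π)).1
          ((oneLine_perm_range π).mem_iff.2 (List.mem_range.2 (by omega : x < n)))
        refine ⟨i, Finset.mem_Iio.2 (lt_of_not_ge fun hji => ?_), rfl⟩
        exact absurd (colHeight_spec π j i (Fin.le_def.1 hji)) (by omega)
    have h2 := (Finset.card_le_card h1).trans Finset.card_image_le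
    rw [Finset.card_union_of_disjoint, hV, Finset.card_range, Fin.card_Iio] at h2
    · omega
    · rw [Finset.disjoint_left]
      intro x hx hx'
      have := (hV' x hx).2.1
      rw [Finset.mem_range] at hx'
      omega
  · rintro ⟨j, hj, h⟩
    obtain ⟨p, hp, hpj⟩ := exists_apply_eq_colHeight (π := π) hj
    have h1 := le_card_larger_left_add (π := π) p
    obtain ⟨i, -, hi⟩ := exists_asc_of_finset (k := t) (π := π)
      (p := fun x => (π p : ℕ) < x ∧ Bef (oneLine π) x (π p))
      (S := Finset.univ.filter fun i => i < p ∧ π p < π i) (by omega)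
      (fun i hi => by
        rw [Finset.mem_filter] at hi
        exact ⟨hi.2.2, bef_oneLine.2 hi.2.1⟩)
      (fun i hi i' hi' hlt => by
        rw [Finset.mem_filter] at hi hi'
        refine lt_of_le_of_ne (not_lt.1 fun hgt => ?_) (π.injective.ne hlt.ne)
        exact hπ i i' p hlt hi'.2.1 hi'.2.2 hgt)
    exact ⟨_, _, hi⟩

end

/-! ### Permutations that avoid `321` and their column heights -/

/-- The heights fix the positions and letters of the right-to-left minima. At the first difference,
the smaller of the two letters occurs later in the other permutation, where it is not a minimum; a
smaller letter after it completes a 321. -/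
theorem eq_of_colHeight_eq {n : ℕ} {π π' : Equiv.Perm (Fin n)} (hπ : Avoids321 (oneLine π))
    (hπ' : Avoids321 (oneLine π')) (h : ∀ i < n, colHeight π i = colHeight π' i) : π = π' := by
  have h' : ∀ i ≤ n, colHeight π i = colHeight π' i := fun i hi => by
    rcases hi.eq_or_lt with rfl | hi
    · rw [colHeight_last, colHeight_last]
    · exact h i hi
  have hrmi : ∀ i, IsRmi π i ↔ IsRmi π' i := fun i => by
    rw [isRmi_iff_colHeight_lt, isRmi_iff_colHeight_lt, h' i i.2.le, h' (i + 1) i.2]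
  have hval : ∀ i, IsRmi π i → π i = π' i := fun i hi => Fin.ext <| by
    rw [← hi.colHeight_eq, ← ((hrmi i).1 hi).colHeight_eq, h i i.2]
  have key : ∀ {σ σ' : Equiv.Perm (Fin n)}, Avoids321 (oneLine σ') →
      (∀ i, IsRmi σ i ↔ IsRmi σ' i) → (∀ i, IsRmi σ i → σ i = σ' i) →
      ∀ i, (∀ k < i, σ k = σ' k) → σ' i ≤ σ i := by
    intro σ σ' hσ' hrmi hval i hi
    rw [avoids321_oneLine_iff] at hσ'
    by_contra! hlt
    obtain ⟨k, hk⟩ := σ'.surjective (σ i)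
    have hik : i < k := by
      rcases lt_trichotomy k i with h1 | rfl | h1
      · exact absurd (σ.injective ((hi k h1).trans hk)) h1.ne
      · exact absurd hk hlt.ne'
      · exact h1
    have hnot : ¬ IsRmi σ' k := fun h1 =>
      hik.ne' (σ.injective ((hval k ((hrmi k).2 h1)).trans hk))
    simp only [IsRmi, not_forall, not_lt] at hnot
    obtain ⟨l, hkl, hl⟩ := hnot
    exact hσ' i k l hik hkl (lt_of_le_of_ne hl (σ'.injective.ne hkl.ne')) (hk ▸ hlt)
  refine Equiv.ext fun i => ?_
  induction i using WellFoundedLT.induction with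
  | _ i ih =>
    exact le_antisymm (key hπ (fun i => (hrmi i).symm)
      (fun i hi => (hval i ((hrmi i).2 hi)).symm) i fun k hk => (ih k hk).symm)
      (key hπ' hrmi hval i ih)

/-- Every path below the diagonal consists of the column heights of a permutation that
avoids `321`. -/
theorem exists_avoids321_colHeight_eq {n : ℕ} {h : ℕ → ℕ} (hmono : ∀ i < n, h i ≤ h (i + 1))
    (hle : ∀ i ≤ n, h i ≤ i) (hn : h n = n) :
    ∃ π : Equiv.Perm (Fin n), Avoids321 (oneLine π) ∧ ∀ i ≤ n, colHeight π i = h i := by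
  classical
  have hmono' : ∀ i j, i ≤ j → j ≤ n → h i ≤ h j := fun i j hij => by
    induction j, hij using Nat.le_induction with
    | base => exact fun _ => le_rfl
    | succ j _ ih => exact fun hj => (ih (by omega)).trans (hmono j (by omega))
  let g : Fin n → Fin n := fun i => ⟨h i, (hle i i.2.le).trans_lt i.2⟩
  -- Columns followed by a north step receive their height as letter; the remaining letters fill the
  -- remaining positions in increasing order.
  let M : Finset (Fin n) := Finset.univ.filter fun i => h i < h (i + 1)
  have hM : ∀ i, i ∈ M ↔ h i < h (i + 1) := fun i => by simp [M]
  have hgM : ∀ i ∈ M, ∀ j, i < j → h i < h j := fun i hi j hij =>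
    ((hM i).1 hi).trans_le (hmono' _ _ (Fin.lt_def.1 hij) j.2.le)
  have hginj : Set.InjOn g M := fun i hi j hj hij => by
    have hij' : h i = h j := congrArg Fin.val hij
    rcases lt_trichotomy i j with h1 | h1 | h1
    · exact absurd hij' (hgM i hi j h1).ne
    · exact h1
    · exact absurd hij' (hgM j hj i h1).ne'
  let V : Finset (Fin n) := M.image g
  have hcard : Mᶜ.card = Vᶜ.card := by
    rw [Finset.card_compl, Finset.card_compl, Finset.card_image_of_injOn hginj]
  let e : (Mᶜ : Finset (Fin n)) ≃o (Vᶜ : Finset (Fin n)) :=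
    (Mᶜ.orderIsoOfFin hcard).symm.trans (Vᶜ.orderIsoOfFin rfl)
  let f : Fin n → Fin n := fun i =>
    if hi : i ∈ M then g i else (e ⟨i, Finset.mem_compl.2 hi⟩ : Fin n)
  have hfM : ∀ i ∈ M, f i = g i := fun i hi => dif_pos hi
  have hfM' : ∀ i (hi : i ∉ M), f i = e ⟨i, Finset.mem_compl.2 hi⟩ := fun i hi => dif_neg hi
  have hfV : ∀ i ∉ M, f i ∉ V := fun i hi => by
    rw [hfM' i hi]
    exact Finset.mem_compl.1 (e ⟨i, Finset.mem_compl.2 hi⟩).2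
  have hflt : ∀ i ∉ M, ∀ j ∉ M, i < j → f i < f j := fun i hi j hj hij => by
    rw [hfM' i hi, hfM' j hj]
    exact e.strictMono hij
  have hinj : Function.Injective f := fun i j hij => by
    by_cases hi : i ∈ M <;> by_cases hj : j ∈ M
    · rw [hfM i hi, hfM j hj] at hij
      exact hginj hi hj hij
    · refine absurd ?_ (hfV j hj)
      rw [← hij, hfM i hi]
      exact Finset.mem_image_of_mem g hi
    · refine absurd ?_ (hfV i hi)
      rw [hij, hfM j hj]
      exact Finset.mem_image_of_mem g hj
    · rcases lt_trichotomy i j with h1 | h1 | h1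
      · exact absurd hij (hflt i hi j hj h1).ne
      · exact h1
      · exact absurd hij (hflt j hj i hi h1).ne'
  let π : Equiv.Perm (Fin n) := Equiv.ofBijective f (Finite.injective_iff_bijective.1 hinj)
  have hπ : ∀ i, π i = f i := fun i => rfl
  have hge : ∀ j : Fin n, h j ≤ f j := fun j => by
    by_cases hj : j ∈ M
    · rw [hfM j hj]
    by_contra! hlt
    -- If `f j < h j`, all j + 1 positions up to j would inject into the h j ≤ j letters below h j:
    -- those outside `M` by `f`, those in `M` by `g`.
    have h1 : ((Finset.Iic j).filter (· ∉ M)).card ≤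
        ((Finset.Iio (g j)).filter (· ∉ V)).card := by
      refine Finset.card_le_card_of_injOn f (fun i hi => ?_) hinj.injOn
      rw [Finset.mem_coe, Finset.mem_filter, Finset.mem_Iic] at hi
      rw [Finset.mem_coe, Finset.mem_filter, Finset.mem_Iio]
      refine ⟨lt_of_le_of_lt ?_ (Fin.lt_def.2 hlt), hfV i hi.2⟩
      rcases hi.1.eq_or_lt with rfl | hij
      exacts [le_rfl, (hflt i hi.2 j hj hij).le]
    have h2 : ((Finset.Iic j).filter (· ∈ M)).card ≤
        ((Finset.Iio (g j)).filter (· ∈ V)).card := by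
      refine Finset.card_le_card_of_injOn g (fun i hi => ?_) (hginj.mono fun i hi => ?_)
      · rw [Finset.mem_coe, Finset.mem_filter, Finset.mem_Iic] at hi
        rw [Finset.mem_coe, Finset.mem_filter, Finset.mem_Iio]
        refine ⟨Fin.lt_def.2 (hgM i hi.2 j (lt_of_le_of_ne hi.1 ?_)),
          Finset.mem_image_of_mem g hi.2⟩
        rintro rfl
        exact hj hi.2
      · exact (Finset.mem_filter.1 hi).2
    have h3 := Finset.card_filter_add_card_filter_not (s := Finset.Iic j) (· ∈ M)
    have h4 := Finset.card_filter_add_card_filter_not (s := Finset.Iio (g j)) (· ∈ V)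
    rw [Fin.card_Iic] at h3
    rw [Fin.card_Iio] at h4
    have h5 : (g j : ℕ) ≤ j := hle j j.2.le
    omega
  refine ⟨π, avoids321_oneLine_iff.2 fun i j k hij hjk hkj hji => ?_, fun i hi => ?_⟩
  · rw [hπ, hπ] at hkj hji
    -- The letters increase both on `M` and on its complement, so an inversion has one position in
    -- each; three positions cannot be pairwise separated in this way.
    have hnot : ∀ i j, i < j → f j < f i → ¬ (i ∈ M ↔ j ∈ M) := fun i j hij hlt hiff => by
      by_cases h1 : i ∈ M
      · rw [hfM i h1, hfM j (hiff.1 h1)] at hlt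
        exact hlt.asymm (Fin.lt_def.2 (hgM i h1 j hij))
      · exact hlt.asymm (hflt i h1 j (fun h2 => h1 (hiff.2 h2)) hij)
    have h1 := hnot i j hij hji
    have h2 := hnot j k hjk hkj
    have h3 := hnot i k (hij.trans hjk) (hkj.trans hji)
    tauto
  · rcases hi.eq_or_lt with rfl | hi
    · rw [colHeight_last, hn]
    refine le_antisymm ?_ ((le_colHeight_iff ((hle i hi.le).trans hi.le)).2 fun j hj =>
      (hmono' i j hj j.2.le).trans (hge j))
    -- The last column at height `h i` is followed by a north step, so it lies in `M` and its letter
    -- attains the height.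
    have hq : h (Nat.findGreatest (fun q => h q = h i) n) = h i :=
      Nat.findGreatest_spec (P := fun q => h q = h i) hi.le rfl
    have hiq : i ≤ Nat.findGreatest (fun q => h q = h i) n := Nat.le_findGreatest hi.le rfl
    have hqn : Nat.findGreatest (fun q => h q = h i) n ≤ n := Nat.findGreatest_le n
    have hq' : ∀ q, Nat.findGreatest (fun q => h q = h i) n < q → q ≤ n → h q ≠ h i :=
      fun q h1 h2 => Nat.findGreatest_is_greatest (P := fun q => h q = h i) h1 h2
    generalize Nat.findGreatest (fun q => h q = h i) n = q at hq hiq hqn hq'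
    have hqlt : q < n := by
      refine lt_of_le_of_ne hqn ?_
      rintro rfl
      have := hle i hi.le
      omega
    have hqM : (⟨q, hqlt⟩ : Fin n) ∈ M := (hM _).2
      (lt_of_le_of_ne (hmono q hqlt) fun h1 => hq' (q + 1) (by omega) hqlt (h1.symm.trans hq))
    have := colHeight_spec π i ⟨q, hqlt⟩ hiq
    rwa [hπ, hfM _ hqM, show ((g ⟨q, hqlt⟩ : Fin n) : ℕ) = h i from hq] at this

/-! ### The bijection `Υ` -/

theorem permTree_injOn {n : ℕ} : Set.InjOn (permTree (n := n)) (avoiders n ![3, 2, 1]) := by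
  intro π hπ π' hπ' h
  rw [mem_avoiders_321_iff] at hπ hπ'
  refine eq_of_colHeight_eq hπ hπ' fun i hi => ?_
  have h1 := treeColumns_permTree π
  rw [h, treeColumns_permTree π', List.map_inj_left] at h1
  have h2 := congrArg Prod.fst (h1 i (List.mem_range.2 hi))
  have h3 := colHeight_le π i hi.le
  have h4 := colHeight_le π' i hi.le
  simp only at h2
  omega

theorem permTree_surjOn {n : ℕ} :
    Set.SurjOn (permTree (n := n)) (avoiders n ![3, 2, 1]) Set.univ := by
  rintro ⟨T, hT⟩ -
  let d : List ℕ := (treeColumns 0 T).map Prod.fst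
  have hlen : d.length = n := by rw [List.length_map, length_treeColumns, hT]
  have hstep : ∀ i (hi : i + 1 < n), d[i + 1]'(by omega) ≤ d[i]'(by omega) + 1 := fun i hi => by
    have h1 := List.isChain_iff_getElem.1 (isChain_treeColumns 0 T) i
      (by rw [length_treeColumns, hT]; exact hi)
    simpa [d] using h1
  have hd : ∀ i (hi : i < n), d[i]'(by omega) ≤ i := fun i => by
    induction i with
    | zero =>
      intro hi
      have h1 : (treeColumns 0 T)[0]?  = some ((treeColumns 0 T)[0]'(by
        rw [length_treeColumns, hT]; exact hi)) := List.getElem?_eq_getElem _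
      rw [← List.head?_eq_getElem?] at h1
      simpa [d] using (head?_treeColumns h1).le
    | succ i ih => exact fun hi => (hstep i hi).trans (Nat.succ_le_succ (ih (by omega)))
  -- The default 0 beyond the last column gives h n = n.
  let h : ℕ → ℕ := fun i => i - d.getD i 0
  have hh : ∀ i (hi : i < n), h i = i - d[i]'(by omega) := fun i hi => by
    simp only [h]
    rw [List.getD_eq_getElem]
  have hhn : h n = n := by
    simp only [h]
    rw [List.getD_eq_default _ _ hlen.le, Nat.sub_zero]
  obtain ⟨π, hπ, hcol⟩ := exists_avoids321_colHeight_eq (n := n) (h := h) (fun i hi => by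
    rcases Nat.lt_or_ge (i + 1) n with h1 | h1
    · rw [hh i hi, hh (i + 1) h1]
      have := hstep i h1
      omega
    · obtain rfl : i + 1 = n := by omega
      rw [hhn, hh i hi]
      omega) (fun i _ => Nat.sub_le _ _) hhn
  refine ⟨π, mem_avoiders_321_iff.2 hπ, Subtype.ext (treeColumns_injective (c := 0) ?_)⟩
  rw [treeColumns_permTree, List.map_map]
  refine List.ext_getElem (by simp [length_treeColumns, hT]) fun i h1 h2 => ?_
  have hi : i < n := by simpa using h1
  have h3 := hd i hi
  simp only [List.getElem_map, List.getElem_range, Function.comp_apply]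
  rw [hcol i hi.le, hh i hi]
  have h4 : d[i]'(by omega) = ((treeColumns 0 T)[i]'(by simpa using h2)).1 := List.getElem_map _
  omega

theorem restrictedMirror_restrictedMirror (T : BinaryTree Unit) :
    restrictedMirror (restrictedMirror T) = T := by
  induction T with
  | nil => rfl
  | node a l r hl hr => rw [restrictedMirror, restrictedMirror, mirror_mirror, hr]

theorem gamma_bijective {n : ℕ} : Function.Bijective (gamma (n := n)) :=
  Function.Involutive.bijective fun T => Subtype.ext (restrictedMirror_restrictedMirror T.1)

theorem upsilon_bijOn {n : ℕ} :
    Set.BijOn (upsilon (n := n)) (avoiders n ![3, 2, 1]) (avoiders n ![2, 1, 3]) :=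
  lambdaInv_bijOn.comp ((Set.bijOn_univ.2 gamma_bijective).comp
    ⟨fun _ _ => trivial, permTree_injOn, permTree_surjOn⟩)

theorem isStackSortable_iff_leftHeight {n t : ℕ} {π : Equiv.Perm (Fin n)}
    (hπ : Avoids321 (oneLine π)) :
    IsStackSortable t π ↔ leftHeight (permTree π).1 ≤ t + 1 := by
  rw [IsStackSortable, iterate_stackSort_eq_range_iff (oneLine_perm_range π)
    (hπ.avoids3241 (nodup_oneLine π)), exists_ascBefore_oneLine_iff hπ, ← not_lt,
    ← exists_mem_treeColumns_iff (c := 0), treeColumns_permTree]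
  simp

theorem isStackSortable_upsilon_iff {n t : ℕ} {π : Equiv.Perm (Fin n)}
    (hπ : Avoids321 (oneLine π)) :
    IsStackSortable t (upsilon π) ↔ IsStackSortable t π := by
  rw [isStackSortable_iff_leftHeight hπ, upsilon_eq, isStackSortable_lambdaInv_iff, gamma,
    ← not_lt, ← not_lt, lt_armRightHeight_restrictedMirror_iff]

theorem upsilon_bijOn_sortableAvoiders {n t : ℕ} :
    Set.BijOn (upsilon (n := n)) (sortableAvoiders n t ![3, 2, 1])
      (sortableAvoiders n t ![2, 1, 3]) := by
  refine ⟨fun π hπ => ⟨?_, upsilon_bijOn.mapsTo hπ.2⟩,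
    upsilon_bijOn.injOn.mono fun π hπ => hπ.2, fun σ hσ => ?_⟩
  · exact (isStackSortable_upsilon_iff (mem_avoiders_321_iff.1 hπ.2)).2 hπ.1
  · obtain ⟨π, hπ, rfl⟩ := upsilon_bijOn.surjOn hσ.2
    exact ⟨π, ⟨(isStackSortable_upsilon_iff (mem_avoiders_321_iff.1 hπ)).1 hσ.1, hπ⟩, rfl⟩

/-! ### The statistics -/

/-- Both sides are the length of the left arm of `permTree π`; below the root, mirroring turns it
into the right arm of the left subtree. -/
theorem pone_eq_rrmi_upsilon {n : ℕ} [NeZero n] (π : Equiv.Perm (Fin n)) :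
    pone π = rrmi (upsilon π) := by
  have hT := treeColumns_permTree π
  rw [upsilon_eq, pone_eq_findIdx]
  rcases h : (permTree π).1 with - | ⟨a, l, r⟩
  · have := (permTree π).2
    rw [h] at this
    exact absurd this.symm (NeZero.ne n)
  · rw [rrmi_lambdaInv (T := gamma (permTree π)) (a := a) (l := mirror l)
      (r := restrictedMirror r) (congrArg restrictedMirror h), rightArm_mirror]
    have h1 := (findIdx_treeColumns (c := 0) (T := .node a l r) (by simp)).1
    rw [← h, hT, h, leftArm] at h1
    rw [← h1, List.findIdx_map, List.findIdx_map]
    rfl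

theorem prmi_eq_rmi_upsilon {n : ℕ} (π : Equiv.Perm (Fin n)) : prmi π = rmi (upsilon π) := by
  rw [upsilon_eq, rmi_lambdaInv, gamma, rightArm_restrictedMirror, ← countP_treeColumns_eq 0,
    treeColumns_permTree, List.countP_map, prmi_eq_countP]
  rfl

theorem inv_eq_rcinv_upsilon {n : ℕ} {π : Equiv.Perm (Fin n)} (hπ : Avoids321 (oneLine π)) :
    inv π = rcinv (upsilon π) := by
  rw [upsilon_eq, rcinv_lambdaInv, gamma, armLeafSum_restrictedMirror, ← sum_treeColumns,
    treeColumns_permTree, List.map_map, inv_eq_sum hπ]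
  simp [Function.comp_def]

end StackSort

theorem mainTheorem4 (n : ℕ) [NeZero n] (t : ℕ) :
    Set.BijOn (StackSort.upsilon (n := n))
      (StackSort.avoiders n ![3, 2, 1]) (StackSort.avoiders n ![2, 1, 3]) ∧
    Set.BijOn (StackSort.upsilon (n := n))
      (StackSort.sortableAvoiders n t ![3, 2, 1]) (StackSort.sortableAvoiders n t ![2, 1, 3]) ∧
    ∀ π ∈ StackSort.sortableAvoiders n t ![3, 2, 1],
      StackSort.pone π = StackSort.rrmi (StackSort.upsilon π) ∧
      StackSort.prmi π = StackSort.rmi (StackSort.upsilon π) ∧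
      StackSort.inv π = StackSort.rcinv (StackSort.upsilon π) :=
  ⟨StackSort.upsilon_bijOn, StackSort.upsilon_bijOn_sortableAvoiders, fun π hπ =>
    ⟨StackSort.pone_eq_rrmi_upsilon π, StackSort.prmi_eq_rmi_upsilon π,
      StackSort.inv_eq_rcinv_upsilon (StackSort.mem_avoiders_321_iff.1 hπ.2)⟩⟩
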